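/- Let $N\ge 1$ and let $M$ be an $N\times N$ matrix from the Gaussian unitary ensemble (GUE) with density proportional to $e^{-\frac N2\operatorname{Tr}M^2}$ on Hermitian matrices; that is, $M$ is Hermitian, its entries on and above the diagonal are independent and centred, the diagonal entries are real Gaussian of variance $\frac1N$, and the entries above the diagonal are complex Gaussian whose real and imaginary parts are independent of variance $\frac1{2N}$. Let $\mathbb{E}^{(H)}_N$ denote the expectation. Define the secular coefficients of $M$ by $$\det(t-M)=\sum_{j=0}^N(-1)^j\,\mathrm{Sc}_j(M)\,t^{N-j},$$ and $\mathrm{Sc}_j(M)=0$ for $j>N$. Let $H_n$ be the monic Hermite polynomials, orthogonal with respect to $e^{-x^2/2}$ on $\mathbb{R}$, and $h_n(x)=N^{-n/2}H_n(\sqrt N\,x)$. Then all the random variables below are integrable, and the following hold. (i) First moments: $\mathbb{E}^{(H)}_N[\mathrm{Sc}_r(M)]=0$ for every odd $r\ge 0$, and for every even $r$ with $0\le r\le N$ $$\mathbb{E}^{(H)}_N[\mathrm{Sc}_r(M)]=(-1)^{r/2}\,\frac{N!}{(2N)^{r/2}\,(r/2)!\,(N-r)!}.$$ (ii) For every $t\in\mathbb{C}$,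 $$\mathbb{E}^{(H)}_N[\det(t-M)]=\sum_{j=0}^{\lfloor N/2\rfloor}\mathbb{E}^{(H)}_N[\mathrm{Sc}_{2j}(M)]\,t^{N-2j}=h_N(t).$$ (iii) For all integers $j,k\ge 0$, $\mathbb{E}^{(H)}_N[\mathrm{Sc}_{2j}(M)\,\mathrm{Sc}_{2k+1}(M)]=0$. (iv) For all integers $r,s\ge 0$ with $2r\le N$ and $2s\le N$, $$\mathbb{E}^{(H)}_N[\mathrm{Sc}_{2r}(M)\,\mathrm{Sc}_{2s}(M)]=\left(-\frac1{2N}\right)^{r+s}\sum_{j=0}^{\min(r,s)}\frac{2^{2j}}{(r-j)!\,(s-j)!}\,\frac{N!\,(N-2j)!}{(N-2r)!\,(N-2s)!}.$$ (v) For all integers $r,s\ge 0$ with $2r+1\le N$ and $2s+1\le N$, $$\mathbb{E}^{(H)}_N[\mathrm{Sc}_{2r+1}(M)\,\mathrm{Sc}_{2s+1}(M)]=\left(-\frac1{2N}\right)^{r+s}\sum_{j=0}^{\min(r,s)}\frac{2^{2j}}{(r-j)!\,(s-j)!}\,\frac{(N-1)!\,(N-2j-1)!}{(N-2r-1)!\,(N-2s-1)!}.$$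 -/

import Mathlib

open MeasureTheory ProbabilityTheory

noncomputable section

/-- The Hermitian `N × N` matrix built from `N²` real numbers `g i j`: real diagonal entries
`g i i / √N`, and entries `(g i j + i g j i) / √(2N)` above the diagonal. -/
def gueMatrix (N : ℕ) (g : Fin N → Fin N → ℝ) : Matrix (Fin N) (Fin N) ℂ :=
  Matrix.of fun i j =>
    if i = j then ((g i i / √(N : ℝ) : ℝ) : ℂ)
    else if i < j then ((g i j : ℂ) + Complex.I * (g j i : ℂ)) / ((√(2 * N : ℝ) : ℝ) : ℂ)
    else ((g j i : ℂ) - Complex.I * (g i j : ℂ)) / ((√(2 * N : ℝ) : ℝ) : ℂ)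

theorem gueMatrix_isHermitian (N : ℕ) (g : Fin N → Fin N → ℝ) :
    (gueMatrix N g).IsHermitian := by
  ext i j
  rcases lt_trichotomy i j with h | h | h
  · simp [gueMatrix, Matrix.conjTranspose_apply, h, h.ne, h.ne', h.not_gt]
  · subst h
    simp [gueMatrix, Matrix.conjTranspose_apply, -Complex.ofReal_div]
  · simp [gueMatrix, Matrix.conjTranspose_apply, h, h.ne, h.ne', h.not_gt, sub_eq_add_neg]

/-- Matrices carry the product σ-algebra of their entries. -/
instance instMeasurableSpaceMatrixFin (N : ℕ) : MeasurableSpace (Matrix (Fin N) (Fin N) ℂ) :=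
  inferInstanceAs (MeasurableSpace (Fin N → Fin N → ℂ))

/-- The law of the `N × N` Gaussian unitary ensemble with density proportional to
`exp (-(N/2) Tr M²)` on Hermitian matrices: the entries on and above the diagonal are independent
and centred, the diagonal ones real Gaussian of variance `1/N`, the others complex Gaussian whose
real and imaginary parts are independent of variance `1/(2N)`. -/
def gueMeasure (N : ℕ) : Measure (Matrix (Fin N) (Fin N) ℂ) :=
  (Measure.pi fun _ : Fin N => Measure.pi fun _ : Fin N => gaussianReal 0 1).map (gueMatrix N)

theorem measurable_gueMatrix (N : ℕ) : Measurable (gueMatrix N) := by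
  refine measurable_pi_lambda _ fun i => measurable_pi_lambda _ fun j => ?_
  simp only [gueMatrix, Matrix.of_apply]
  split_ifs <;> fun_prop

instance isProbabilityMeasure_gueMeasure (N : ℕ) : IsProbabilityMeasure (gueMeasure N) :=
  Measure.isProbabilityMeasure_map (measurable_gueMatrix N).aemeasurable

/-- The `r`-th secular coefficient of an `N × N` matrix `M`, i.e. `(-1)^r` times the coefficient
of `t^(N-r)` in `det (t - M)` for `r ≤ N`, and `0` for `r > N`. -/
def secular {N : ℕ} (r : ℕ) (M : Matrix (Fin N) (Fin N) ℂ) : ℂ :=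
  if r ≤ N then (-1) ^ r * M.charpoly.coeff (N - r) else 0

/-- The secular coefficients are determined by `det (t - M) = ∑_j (-1)^j Sc_j(M) t^(N-j)`. -/
theorem det_sub_eq_sum_secular {N : ℕ} (M : Matrix (Fin N) (Fin N) ℂ) (t : ℂ) :
    (Matrix.scalar (Fin N) t - M).det =
      ∑ j ∈ Finset.range (N + 1), (-1) ^ j * secular j M * t ^ (N - j) := by
  rw [← Matrix.eval_charpoly, Polynomial.eval_eq_sum_range, Matrix.charpoly_natDegree_eq_dim,
    Fintype.card_fin, ← Finset.sum_range_reflect]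
  refine Finset.sum_congr rfl fun j hj => ?_
  have hj' : j ≤ N := Nat.lt_succ_iff.mp (Finset.mem_range.mp hj)
  have h1 : N + 1 - 1 - j = N - j := by omega
  rw [h1, secular, if_pos hj', ← mul_assoc, ← pow_add, Even.neg_one_pow ⟨j, rfl⟩, one_mul]

/-- `h_n(x) = N^(-n/2) H_n(√N x)`, the monic Hermite polynomials orthogonal for the weight
`exp (-N x² / 2)`; `H_n` is the probabilists' Hermite polynomial, orthogonal for
`exp (-x² / 2)`. -/
def scaledHermite (N n : ℕ) (x : ℂ) : ℂ :=
  (((√(N : ℝ) : ℝ) : ℂ) ^ n)⁻¹ *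
    Polynomial.aeval (((√(N : ℝ) : ℝ) : ℂ) * x) (Polynomial.hermite n)

end

/-! All moments come from one identity: up to powers of 1/√N, the coefficients of E[det(x - M) det(y
- M)] are those of the Hermite kernel K(x, y) = ∑_{k ≤ N} (N!/k!) H_k(x) H_k(y) (`gueMoment_eq`).
Both families solve the same recursion.

On the matrix side, the coefficient c_a of t^a in p(t) = det(t - M) is a homogeneous polynomial of
degree N - a in independent standard Gaussians, so Euler's identity and Gaussian integration by
parts give (2N - a - b) E[c_a c_b] = E[Δ(c_a c_b)]. The covariance E[M_ij M_lm] = δ_im δ_jl / N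
turns sums over the Gaussians into traces: Δp = -p''/N, and ⟨∇p(x), ∇p(y)⟩ = G(x, y)/N with G(x, y)
= tr(adj(x - M) adj(y - M)). Since (x - M) adj(x - M) = p(x) and tr adj(x - M) = p'(x), the trace
satisfies (x - y) G = p(x) p'(y) - p'(x) p(y), which expresses its coefficients through products c_a
c_b.

On the Hermite side, the equation x H_k' = k H_k + H_k'' gives the same Euler relation for K, with W
= ∑_{k ≤ N} (N - k)(N!/k!) H_k(x) H_k(y) in place of G; summing Christoffel–Darboux over its upper
limit gives (x - y) W = ∂_y K - ∂_x K.

Strong induction on 2N - a - b identifies the two. First moments are the case Sc_0 = 1, where K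
reduces to H_N; the closed formulas follow from the explicit Hermite coefficients, and the vanishing
ones from parity. -/

/-! ### Derivations of determinants and of polynomials. -/

theorem Derivation.map_finset_prod {R A ι : Type*} [CommRing R] [CommRing A] [Algebra R A]
    [DecidableEq ι] (d : Derivation R A A) (s : Finset ι) (f : ι → A) :
    d (∏ i ∈ s, f i) = ∑ i ∈ s, (∏ j ∈ s.erase i, f j) * d (f i) := by
  induction s using Finset.induction_on with
  | empty => simp
  | insert a s ha ih =>
    rw [Finset.prod_insert ha, d.leibniz, ih, Finset.sum_insert ha, Finset.erase_insert ha,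
      smul_eq_mul, smul_eq_mul, Finset.mul_sum, add_comm]
    congr 1
    refine Finset.sum_congr rfl fun i hi => ?_
    have hia : a ≠ i := fun h => ha (h ▸ hi)
    rw [Finset.erase_insert_of_ne hia, Finset.prod_insert (by simp [ha]), mul_assoc]

/-- **Jacobi's formula** for a derivation. -/
theorem Derivation.map_det {R A n : Type*} [CommRing R] [CommRing A] [Algebra R A]
    [Fintype n] [DecidableEq n] (d : Derivation R A A) (M : Matrix n n A) :
    d M.det = (M.adjugate * M.map d).trace := by
  -- By Cramer's rule the trace is the sum over columns of the determinant with that column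
  -- differentiated.
  have h : (M.adjugate * M.map d).trace = ∑ i, (M.updateCol i fun j => d (M j i)).det := by
    refine Finset.sum_congr rfl fun i _ => ?_
    rw [← Matrix.cramer_apply, Matrix.cramer_eq_adjugate_mulVec]
    rfl
  rw [h, Matrix.det_apply]
  simp only [Matrix.det_apply, map_sum]
  rw [Finset.sum_comm]
  refine Finset.sum_congr rfl fun σ _ => ?_
  rw [Units.smul_def, map_zsmul, d.map_finset_prod, Finset.smul_sum]
  refine Finset.sum_congr rfl fun i _ => ?_
  rw [Units.smul_def, ← Finset.mul_prod_erase _ _ (Finset.mem_univ i), mul_comm]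
  congr 2
  · simp
  · refine Finset.prod_congr rfl fun j hj => ?_
    rw [Matrix.updateCol_ne (Finset.ne_of_mem_erase hj)]

theorem Derivation.map_trace_mul {R A n : Type*} [CommRing R] [CommRing A] [Algebra R A]
    [Fintype n] (d : Derivation R A A) (M M' : Matrix n n A) :
    d (M * M').trace = (M.map d * M').trace + (M * M'.map d).trace := by
  simp only [Matrix.trace, Matrix.diag, Matrix.mul_apply, map_sum, d.leibniz, smul_eq_mul,
    Matrix.map_apply, ← Finset.sum_add_distrib]
  exact Finset.sum_congr rfl fun i _ => Finset.sum_congr rfl fun j _ => by ring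

theorem Derivation.map_matrix_mul {R A n : Type*} [CommRing R] [CommRing A] [Algebra R A]
    [Fintype n] (d : Derivation R A A) (M M' : Matrix n n A) :
    (M * M').map d = M.map d * M' + M * M'.map d := by
  ext i j
  simp only [Matrix.mul_apply, map_sum, d.leibniz, smul_eq_mul, Matrix.add_apply,
    Matrix.map_apply, ← Finset.sum_add_distrib]
  exact Finset.sum_congr rfl fun k _ => by ring

/-- The second derivative of a determinant along an affine family. -/
theorem Derivation.det_mul_map_map_det {R A n : Type*} [CommRing R] [CommRing A] [Algebra R A]
    [Fintype n] [DecidableEq n] (d : Derivation R A A) (M : Matrix n n A)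
    (hM : (M.map d).map d = 0) :
    M.det * d (d M.det) = (M.adjugate * M.map d).trace * (M.adjugate * M.map d).trace -
      (M.adjugate * M.map d * (M.adjugate * M.map d)).trace := by
  have h1 : d (d M.det) = (M.adjugate.map d * M.map d).trace := by
    conv_lhs => rw [d.map_det, d.map_trace_mul, hM]
    simp
  have h2 : (M.adjugate * M).map d = M.adjugate.map d * M + M.adjugate * M.map d :=
    d.map_matrix_mul _ _
  have h3 : (M.adjugate * M).map d = d M.det • (1 : Matrix n n A) := by
    rw [Matrix.adjugate_mul]
    ext i j
    by_cases hij : i = j <;> simp [hij]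
  -- The derivative of the adjugate without inverting `M`: differentiate `adj M * M = det M • 1`,
  -- then multiply on the right by `adj M`.
  have h4 : M.det • M.adjugate.map d =
      d M.det • M.adjugate - M.adjugate * M.map d * M.adjugate := by
    have h5 : M.adjugate.map d * M = d M.det • (1 : Matrix n n A) - M.adjugate * M.map d := by
      rw [← h3, h2, add_sub_cancel_right]
    calc M.det • M.adjugate.map d = M.adjugate.map d * (M * M.adjugate) := by
          rw [Matrix.mul_adjugate, Matrix.mul_smul, Matrix.mul_one]
      _ = _ := by rw [← Matrix.mul_assoc, h5, Matrix.sub_mul, Matrix.smul_mul, Matrix.one_mul]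
  rw [h1, ← smul_eq_mul, ← Matrix.trace_smul, ← Matrix.smul_mul, h4, Matrix.sub_mul,
    Matrix.trace_sub, Matrix.smul_mul, Matrix.trace_smul, d.map_det, smul_eq_mul]
  simp only [Matrix.mul_assoc]

/-- A derivation of `A` acts on `A[X]` coefficientwise. -/
noncomputable def Derivation.polynomial {R A : Type*} [CommRing R] [CommRing A] [Algebra R A]
    (d : Derivation R A A) : Derivation R (Polynomial A) (Polynomial A) :=
  PolynomialModule.equivPolynomialSelf.toLinearMap.compDer d.mapCoeffs

section
variable {R A : Type*} [CommRing R] [CommRing A] [Algebra R A] (d : Derivation R A A)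

theorem Derivation.coeff_polynomial (p : Polynomial A) (n : ℕ) :
    (d.polynomial p).coeff n = d (p.coeff n) := rfl

theorem Derivation.polynomial_C (a : A) : d.polynomial (Polynomial.C a) = Polynomial.C (d a) := by
  ext n
  rw [d.coeff_polynomial, Polynomial.coeff_C, Polynomial.coeff_C]
  split_ifs <;> simp

theorem Derivation.polynomial_X : d.polynomial Polynomial.X = 0 := by
  ext n
  rw [d.coeff_polynomial, Polynomial.coeff_X, Polynomial.coeff_zero]
  split_ifs <;> simp

theorem Derivation.map_charmatrix {n : Type*} [Fintype n] [DecidableEq n] (M : Matrix n n A) :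
    M.charmatrix.map d.polynomial = -(M.map fun a => Polynomial.C (d a)) := by
  ext1 i j
  rw [Matrix.map_apply, Matrix.charmatrix_apply, Matrix.neg_apply, Matrix.map_apply, map_sub,
    d.polynomial_C, Matrix.diagonal_apply]
  split_ifs <;> simp [d.polynomial_X]

end

/-! ### Contracting traces against a covariance of unitary type. -/

section
variable {S n κ : Type*} [CommRing S] [Fintype n]

theorem trace_mul_eq_sum (B E : Matrix n n S) :
    (B * E).trace = ∑ p : n × n, B p.1 p.2 * E p.2 p.1 := by
  simp only [Matrix.trace, Matrix.diag, Matrix.mul_apply, Fintype.sum_prod_type]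

variable [DecidableEq n] [Fintype κ] {E : κ → Matrix n n S} {τ : S}

/-- The covariance pairs the entry (i, j) only with (j, i), so contracting two separate traces
merges them into one. -/
theorem sum_trace_mul_trace
    (hE : ∀ i j l m, ∑ k, E k i j * E k l m = if i = m ∧ j = l then τ else 0)
    (B B' : Matrix n n S) :
    ∑ k, (B * E k).trace * (B' * E k).trace = τ * (B * B').trace := by
  have h : ∀ p q : n × n, ∑ k, B p.1 p.2 * E k p.2 p.1 * (B' q.1 q.2 * E k q.2 q.1) =
      if q = p.swap then τ * (B p.1 p.2 * B' p.2 p.1) else 0 := by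
    intro p q
    have h1 : ∑ k, B p.1 p.2 * E k p.2 p.1 * (B' q.1 q.2 * E k q.2 q.1) =
        B p.1 p.2 * B' q.1 q.2 * ∑ k, E k p.2 p.1 * E k q.2 q.1 := by
      rw [Finset.mul_sum]
      exact Finset.sum_congr rfl fun k _ => by ring
    rw [h1, hE]
    by_cases hpq : q = p.swap
    · subst hpq
      simp [mul_comm]
    · rw [if_neg hpq, if_neg, mul_zero]
      rintro ⟨h2, h3⟩
      exact hpq (Prod.ext h2.symm h3.symm)
  simp only [trace_mul_eq_sum, Finset.sum_mul_sum]
  rw [Finset.sum_comm, Finset.mul_sum]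
  refine Finset.sum_congr rfl fun p _ => ?_
  rw [Finset.sum_comm, Finset.sum_congr rfl fun q _ => h p q]
  simp

/-- The dual rule: contracting inside a single trace splits it into two. -/
theorem sum_trace_mul_mul
    (hE : ∀ i j l m, ∑ k, E k i j * E k l m = if i = m ∧ j = l then τ else 0)
    (B B' : Matrix n n S) :
    ∑ k, (B * E k * (B' * E k)).trace = τ * (B.trace * B'.trace) := by
  have h : ∀ i m j l : n, ∑ k, B i j * E k j m * (B' m l * E k l i) =
      if j = i then (if l = m then τ * (B i i * B' m m) else 0) else 0 := by
    intro i m j l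
    have h1 : ∑ k, B i j * E k j m * (B' m l * E k l i) =
        B i j * B' m l * ∑ k, E k j m * E k l i := by
      rw [Finset.mul_sum]
      exact Finset.sum_congr rfl fun k _ => by ring
    rw [h1, hE]
    by_cases hj : j = i
    · by_cases hl : l = m
      · subst hj hl
        simp [mul_comm]
      · simp [hl, Ne.symm hl]
    · simp [hj]
  simp only [Matrix.trace, Matrix.diag, Matrix.mul_apply (M := _ * _), Matrix.mul_apply (M := B),
    Matrix.mul_apply (M := B'), Finset.sum_mul_sum]
  rw [Finset.sum_comm, Finset.mul_sum]
  refine Finset.sum_congr rfl fun i _ => ?_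
  rw [Finset.sum_comm, Finset.mul_sum]
  refine Finset.sum_congr rfl fun m _ => ?_
  rw [Finset.sum_comm, Finset.sum_congr rfl fun j _ => Finset.sum_comm]
  simp only [h]
  simp

end

/-! ### The adjugate of the characteristic matrix, coefficient by coefficient. -/

section
variable {A n : Type*} [CommRing A] [Fintype n] [DecidableEq n] (M : Matrix n n A)

/-- The coefficients of the adjugate of the characteristic matrix. -/
noncomputable def adjCoeff (a : ℕ) : Matrix n n A := M.charmatrix.adjugate.map fun p => p.coeff a

/-- The coefficients of `X` times the adjugate of the characteristic matrix. -/
noncomputable def adjXCoeff (a : ℕ) : Matrix n n A :=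
  M.charmatrix.adjugate.map fun p => (Polynomial.X * p).coeff a

theorem adjXCoeff_zero : adjXCoeff M 0 = 0 := by
  ext i j
  simp [adjXCoeff]

theorem adjXCoeff_succ (a : ℕ) : adjXCoeff M (a + 1) = adjCoeff M a := by
  ext i j
  simp [adjXCoeff, adjCoeff, Polynomial.coeff_X_mul]

theorem charmatrix_eq_smul_sub :
    M.charmatrix = (Polynomial.X : Polynomial A) • (1 : Matrix n n (Polynomial A)) -
      M.map Polynomial.C := by
  ext1 i j
  rcases eq_or_ne i j with rfl | hij
  · rw [Matrix.charmatrix_apply_eq, Matrix.sub_apply, Matrix.smul_apply, Matrix.one_apply_eq,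
      Matrix.map_apply, smul_eq_mul, mul_one]
  · rw [Matrix.charmatrix_apply_ne _ _ _ hij, Matrix.sub_apply, Matrix.smul_apply,
      Matrix.one_apply_ne hij, Matrix.map_apply, smul_zero, zero_sub]

theorem adjXCoeff_sub_mul_adjCoeff (a : ℕ) :
    adjXCoeff M a - M * adjCoeff M a = M.charpoly.coeff a • (1 : Matrix n n A) := by
  have h := Matrix.mul_adjugate M.charmatrix
  nth_rw 1 [charmatrix_eq_smul_sub] at h
  rw [Matrix.sub_mul, Matrix.smul_mul, Matrix.one_mul] at h
  ext i j
  have h2 := congrArg (fun p => Polynomial.coeff p a) (congrFun (congrFun h i) j)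
  simp only [Matrix.sub_apply, Matrix.smul_apply, smul_eq_mul, Polynomial.coeff_sub,
    Matrix.mul_apply, Matrix.map_apply, Polynomial.finsetSum_coeff, Polynomial.coeff_C_mul] at h2
  rw [Matrix.sub_apply, Matrix.mul_apply, Matrix.smul_apply, smul_eq_mul]
  simp only [adjXCoeff, adjCoeff, Matrix.map_apply]
  rw [h2, Matrix.charpoly]
  rcases eq_or_ne i j with rfl | hij
  · rw [Matrix.one_apply_eq, Matrix.one_apply_eq, mul_one, mul_one]
  · rw [Matrix.one_apply_ne hij, Matrix.one_apply_ne hij, mul_zero, mul_zero, Polynomial.coeff_zero]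

theorem adjXCoeff_sub_adjCoeff_mul (a : ℕ) :
    adjXCoeff M a - adjCoeff M a * M = M.charpoly.coeff a • (1 : Matrix n n A) := by
  have h := Matrix.adjugate_mul M.charmatrix
  nth_rw 2 [charmatrix_eq_smul_sub] at h
  rw [Matrix.mul_sub, Matrix.mul_smul, Matrix.mul_one] at h
  ext i j
  have h2 := congrArg (fun p => Polynomial.coeff p a) (congrFun (congrFun h i) j)
  simp only [Matrix.sub_apply, Matrix.smul_apply, smul_eq_mul, Polynomial.coeff_sub,
    Matrix.mul_apply, Matrix.map_apply, Polynomial.finsetSum_coeff, Polynomial.coeff_mul_C] at h2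
  rw [Matrix.sub_apply, Matrix.mul_apply, Matrix.smul_apply, smul_eq_mul]
  simp only [adjXCoeff, adjCoeff, Matrix.map_apply]
  rw [h2, Matrix.charpoly]
  rcases eq_or_ne i j with rfl | hij
  · rw [Matrix.one_apply_eq, Matrix.one_apply_eq, mul_one, mul_one]
  · rw [Matrix.one_apply_ne hij, Matrix.one_apply_ne hij, mul_zero, mul_zero, Polynomial.coeff_zero]

/-- The derivative of polynomials, as a derivation over the coefficient ring. -/
noncomputable def polynomialDerivation (A : Type*) [CommRing A] :
    Derivation A (Polynomial A) (Polynomial A) := Polynomial.derivative'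

theorem polynomialDerivation_apply (p : Polynomial A) :
    polynomialDerivation A p = Polynomial.derivative p := rfl

theorem charmatrix_map_derivative : M.charmatrix.map (polynomialDerivation A) = 1 := by
  ext1 i j
  rw [Matrix.map_apply, polynomialDerivation_apply]
  rcases eq_or_ne i j with rfl | hij
  · rw [Matrix.charmatrix_apply_eq, Matrix.one_apply_eq]
    simp
  · rw [Matrix.charmatrix_apply_ne _ _ _ hij, Matrix.one_apply_ne hij]
    simp

theorem derivative_charpoly :
    Polynomial.derivative M.charpoly = M.charmatrix.adjugate.trace := by
  rw [← polynomialDerivation_apply, Matrix.charpoly, Derivation.map_det, charmatrix_map_derivative,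
    Matrix.mul_one]

/-- The second-derivative formula for determinants along d/dX, for which the characteristic matrix
has derivative 1. -/
theorem charpoly_mul_derivative_derivative :
    M.charpoly * Polynomial.derivative (Polynomial.derivative M.charpoly) =
      M.charmatrix.adjugate.trace * M.charmatrix.adjugate.trace -
        (M.charmatrix.adjugate * M.charmatrix.adjugate).trace := by
  have h := (polynomialDerivation A).det_mul_map_map_det M.charmatrix (by
    rw [charmatrix_map_derivative]
    ext1 i j
    by_cases hij : i = j <;> simp [hij, polynomialDerivation_apply])
  rw [charmatrix_map_derivative, Matrix.mul_one] at h
  exact h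

theorem trace_adjCoeff (a : ℕ) :
    (adjCoeff M a).trace = M.charpoly.coeff (a + 1) * (a + 1) := by
  rw [← Polynomial.coeff_derivative, derivative_charpoly, Matrix.trace, Matrix.trace,
    Polynomial.finsetSum_coeff]
  rfl

/-- The coefficient of x^a y^b in (x - y) tr(adj(x - M) adj(y - M)) = p(x) p'(y) - p(y) p'(x). The
terms containing `M` cancel by cyclicity of the trace. -/
theorem trace_adjXCoeff_mul_adjCoeff (a b : ℕ) :
    (adjXCoeff M a * adjCoeff M b).trace - (adjCoeff M a * adjXCoeff M b).trace =
      M.charpoly.coeff a * (M.charpoly.coeff (b + 1) * (b + 1)) -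
        M.charpoly.coeff b * (M.charpoly.coeff (a + 1) * (a + 1)) := by
  have h1 := eq_add_of_sub_eq (adjXCoeff_sub_mul_adjCoeff M a)
  have h2 := eq_add_of_sub_eq (adjXCoeff_sub_adjCoeff_mul M b)
  rw [h1, h2, Matrix.add_mul, Matrix.mul_add, Matrix.trace_add, Matrix.trace_add, Matrix.smul_mul,
    Matrix.mul_smul, Matrix.one_mul, Matrix.mul_one, Matrix.trace_smul, Matrix.trace_smul,
    trace_adjCoeff, trace_adjCoeff, Matrix.mul_assoc, Matrix.trace_mul_comm M, Matrix.mul_assoc,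
    smul_eq_mul, smul_eq_mul]
  ring

end

/-! ### Gradient, Laplacian and Euler field on the characteristic polynomial. -/

section
variable {R A n κ : Type*} [CommRing R] [CommRing A] [Algebra R A] [Fintype n] [DecidableEq n]
  [Fintype κ] (M : Matrix n n A)

theorem Derivation.map_charpoly (d : Derivation R A A) :
    d.polynomial M.charpoly =
      -(M.charmatrix.adjugate * M.map fun a => Polynomial.C (d a)).trace := by
  rw [Matrix.charpoly, Derivation.map_det, d.map_charmatrix, Matrix.mul_neg, Matrix.trace_neg]

theorem Derivation.map_charpoly_coeff (d : Derivation R A A) (a : ℕ) :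
    d (M.charpoly.coeff a) = -(adjCoeff M a * M.map d).trace := by
  rw [← d.coeff_polynomial, d.map_charpoly, Polynomial.coeff_neg, trace_mul_eq_sum,
    trace_mul_eq_sum, Polynomial.finsetSum_coeff]
  simp [adjCoeff]

variable {d : κ → Derivation R A A} {τ : A}

theorem sum_map_charpoly_coeff_mul
    (hd : ∀ i j l m, ∑ k, d k (M i j) * d k (M l m) = if i = m ∧ j = l then τ else 0) (a b : ℕ) :
    ∑ k, d k (M.charpoly.coeff a) * d k (M.charpoly.coeff b) =
      τ * (adjCoeff M a * adjCoeff M b).trace := by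
  simp only [Derivation.map_charpoly_coeff, neg_mul_neg]
  exact sum_trace_mul_trace (E := fun k => M.map (d k)) hd _ _

/-- This is Δp = -τ p''. Contraction exchanges (tr adj)² with tr(adj²) in the second-derivative
formula, so p Δp is -τ times the same expression for d/dX, that is, -τ p p''. The monic p then
cancels in a domain. -/
theorem sum_map_map_charpoly_coeff [IsDomain A]
    (hd : ∀ i j l m, ∑ k, d k (M i j) * d k (M l m) = if i = m ∧ j = l then τ else 0)
    (hdd : ∀ k i j, d k (d k (M i j)) = 0) (a : ℕ) :
    ∑ k, d k (d k (M.charpoly.coeff a)) =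
      -(τ * ((a + 2) * (a + 1) * M.charpoly.coeff (a + 2))) := by
  have hE : ∀ i j l m, ∑ k, (M.charmatrix.map (d k).polynomial) i j *
      (M.charmatrix.map (d k).polynomial) l m =
        if i = m ∧ j = l then Polynomial.C τ else 0 := by
    intro i j l m
    have h : ∀ k, (M.charmatrix.map (d k).polynomial) i j *
        (M.charmatrix.map (d k).polynomial) l m = Polynomial.C (d k (M i j) * d k (M l m)) := by
      intro k
      rw [Derivation.map_charmatrix, Matrix.neg_apply, Matrix.neg_apply, Matrix.map_apply,
        Matrix.map_apply, neg_mul_neg, Polynomial.C_mul]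
    rw [Finset.sum_congr rfl fun k _ => h k, ← map_sum, hd]
    split_ifs <;> simp
  have h1 : ∀ k, M.charpoly * (d k).polynomial ((d k).polynomial M.charpoly) = _ := fun k =>
    (d k).polynomial.det_mul_map_map_det M.charmatrix (by
      rw [Derivation.map_charmatrix]
      ext1 i j
      simp [Derivation.polynomial_C, hdd])
  have h2 : M.charpoly * (∑ k, (d k).polynomial ((d k).polynomial M.charpoly)) =
      M.charpoly * -(Polynomial.C τ * Polynomial.derivative (Polynomial.derivative M.charpoly)) := by
    rw [Finset.mul_sum, Finset.sum_congr rfl fun k _ => h1 k, Finset.sum_sub_distrib,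
      sum_trace_mul_trace hE, sum_trace_mul_mul hE]
    linear_combination Polynomial.C τ * charpoly_mul_derivative_derivative M
  have h3 := congrArg (fun p => Polynomial.coeff p a)
    (mul_left_cancel₀ M.charpoly_monic.ne_zero h2)
  simp only [Polynomial.finsetSum_coeff, Derivation.coeff_polynomial, Polynomial.coeff_neg,
    Polynomial.coeff_C_mul, Polynomial.coeff_derivative] at h3
  rw [h3]
  push_cast
  ring

/-- Euler's identity: the field ∑ x_k d_k fixes every entry of `M`, so it multiplies the coefficient
of degree n - a in the entries by n - a. The trace of adj · (X - M) = p · 1 yields it once tr adj =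
p'. -/
theorem sum_mul_map_charpoly_coeff (x : κ → A) (hx : ∀ i j, ∑ k, x k * d k (M i j) = M i j)
    (a : ℕ) :
    ∑ k, x k * d k (M.charpoly.coeff a) = (Fintype.card n - a) * M.charpoly.coeff a := by
  have h1 : ∑ k, x k * d k (M.charpoly.coeff a) = -(adjCoeff M a * M).trace := by
    simp only [Derivation.map_charpoly_coeff, trace_mul_eq_sum, mul_neg, Finset.sum_neg_distrib,
      Finset.mul_sum, Matrix.map_apply]
    rw [Finset.sum_comm]
    congr 1
    refine Finset.sum_congr rfl fun p _ => ?_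
    conv_rhs => rw [← hx, Finset.mul_sum]
    exact Finset.sum_congr rfl fun k _ => by ring
  have h2 := congrArg Matrix.trace (adjXCoeff_sub_adjCoeff_mul M a)
  rw [Matrix.trace_sub, Matrix.trace_smul, Matrix.trace_one, smul_eq_mul] at h2
  have h3 : (adjXCoeff M a).trace = a * M.charpoly.coeff a := by
    rcases a with _ | a
    · simp [adjXCoeff_zero]
    · rw [adjXCoeff_succ, trace_adjCoeff]
      push_cast
      ring
  rw [h1]
  linear_combination h2 - h3

end

/-! ### Hermite polynomials, Christoffel–Darboux and the Hermite kernel. -/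

open Polynomial in
theorem derivative_hermite_succ (n : ℕ) :
    derivative (hermite (n + 1)) = ((n : ℤ[X]) + 1) * hermite n := by
  induction n with
  | zero => simp
  | succ n ih =>
    conv_lhs => rw [hermite_succ, derivative_sub, derivative_mul, derivative_X, ih]
    rw [hermite_succ n]
    simp only [derivative_mul, derivative_add, derivative_natCast, derivative_one]
    push_cast
    ring

/-- The coefficient of `x^a` in the Hermite polynomial `H_k`. -/
noncomputable def hermiteCoeff (k a : ℕ) : ℂ := ((Polynomial.hermite k).coeff a : ℂ)

/-- The coefficient of `x^a` in `x H_k(x)`. -/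
noncomputable def hermiteXCoeff (k a : ℕ) : ℂ := ((Polynomial.X * Polynomial.hermite k).coeff a : ℂ)

theorem hermiteXCoeff_zero (k : ℕ) : hermiteXCoeff k 0 = 0 := by simp [hermiteXCoeff]

theorem hermiteXCoeff_succ (k a : ℕ) : hermiteXCoeff k (a + 1) = hermiteCoeff k a := by
  simp [hermiteXCoeff, hermiteCoeff, Polynomial.coeff_X_mul]

theorem succ_mul_hermiteCoeff (k a : ℕ) :
    ((a : ℂ) + 1) * hermiteCoeff k (a + 1) = k * hermiteCoeff (k - 1) a := by
  rcases k with _ | k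
  · simp [hermiteCoeff, Polynomial.coeff_one]
  · have h := congrArg (fun p => ((p.coeff a : ℤ) : ℂ)) (derivative_hermite_succ k)
    have h2 : ((k : Polynomial ℤ) + 1) = Polynomial.C ((k : ℤ) + 1) := by simp
    simp only [Polynomial.coeff_derivative, h2, Polynomial.coeff_C_mul] at h
    push_cast at h
    rw [hermiteCoeff, hermiteCoeff, mul_comm, h]
    simp

theorem hermiteXCoeff_sub (k a : ℕ) :
    hermiteCoeff (k + 1) a = hermiteXCoeff k a - (a + 1) * hermiteCoeff k (a + 1) := by
  rw [hermiteCoeff, Polynomial.hermite_succ, Polynomial.coeff_sub, Polynomial.coeff_derivative,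
    hermiteXCoeff, hermiteCoeff]
  push_cast
  ring

/-- The three-term recurrence. At `k = 0` the truncated index `k - 1` is harmless, as its factor `k`
vanishes. -/
theorem hermiteXCoeff_eq (k a : ℕ) :
    hermiteXCoeff k a = hermiteCoeff (k + 1) a + k * hermiteCoeff (k - 1) a := by
  rw [hermiteXCoeff_sub, succ_mul_hermiteCoeff]
  ring

/-- Hermite's equation x H_k' = k H_k + H_k'', read at x^a. -/
theorem hermiteCoeff_ode (k a : ℕ) :
    (a : ℂ) * hermiteCoeff k a =
      k * hermiteCoeff k a + (a + 2) * (a + 1) * hermiteCoeff k (a + 2) := by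
  have h1 : (a : ℂ) * hermiteCoeff k a = k * hermiteXCoeff (k - 1) a := by
    rcases a with _ | a
    · simp [hermiteXCoeff_zero]
    · rw [hermiteXCoeff_succ, ← succ_mul_hermiteCoeff]
      push_cast
      ring
  have h2 : ((a : ℂ) + 2) * hermiteCoeff k (a + 2) = k * hermiteCoeff (k - 1) (a + 1) := by
    rw [← succ_mul_hermiteCoeff]
    push_cast
    ring
  have h3 : (k : ℂ) * hermiteCoeff k a =
      k * (hermiteXCoeff (k - 1) a - (a + 1) * hermiteCoeff (k - 1) (a + 1)) := by
    rcases k with _ | k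
    · simp
    · rw [hermiteXCoeff_sub, Nat.add_sub_cancel]
  linear_combination h1 - h3 - (a + 1) * h2

/-- The Christoffel–Darboux identity, for two sequences obeying the Hermite recursion. -/
theorem christoffel_darboux (p q p' q' : ℕ → ℂ) (hp : ∀ k, p' k = p (k + 1) + k * p (k - 1))
    (hq : ∀ k, q' k = q (k + 1) + k * q (k - 1)) (N : ℕ) :
    ∑ k ∈ Finset.range (N + 1), (p k * q' k - p' k * q k) / (k.factorial : ℂ) =
      (p N * q (N + 1) - p (N + 1) * q N) / (N.factorial : ℂ) := by
  induction N with
  | zero => simp [hp, hq]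
  | succ N ih =>
    rw [Finset.sum_range_succ, ih, hp, hq, Nat.factorial_succ]
    have h : (N.factorial : ℂ) ≠ 0 := by exact_mod_cast N.factorial_ne_zero
    have h' : (N : ℂ) + 1 ≠ 0 := by exact_mod_cast N.succ_ne_zero
    push_cast
    field_simp
    ring

/-- A summed form of the Christoffel–Darboux identity. -/
theorem christoffel_darboux_sum (p q p' q' : ℕ → ℂ) (hp : ∀ k, p' k = p (k + 1) + k * p (k - 1))
    (hq : ∀ k, q' k = q (k + 1) + k * q (k - 1)) (N : ℕ) :
    ∑ k ∈ Finset.range (N + 1), ((N : ℂ) - k) * (p k * q' k - p' k * q k) / (k.factorial : ℂ) =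
      ∑ k ∈ Finset.range (N + 1), k * (p (k - 1) * q k - p k * q (k - 1)) / (k.factorial : ℂ) := by
  induction N with
  | zero => simp
  | succ N ih =>
    have h : (N.factorial : ℂ) ≠ 0 := by exact_mod_cast N.factorial_ne_zero
    have h' : (N : ℂ) + 1 ≠ 0 := by exact_mod_cast N.succ_ne_zero
    rw [Finset.sum_range_succ, Finset.sum_range_succ _ (N + 1), ← ih]
    -- Raising `N` by one raises each weight `N - k` by one, which adds a full Christoffel–Darboux
    -- sum; its closed form is exactly the new term on the right. The new term on the left has
    -- weight 0.
    have h2 : ∑ k ∈ Finset.range (N + 1),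
        (((N + 1 : ℕ) : ℂ) - k) * (p k * q' k - p' k * q k) / (k.factorial : ℂ) =
        ∑ k ∈ Finset.range (N + 1), ((N : ℂ) - k) * (p k * q' k - p' k * q k) / (k.factorial : ℂ) +
        ∑ k ∈ Finset.range (N + 1), (p k * q' k - p' k * q k) / (k.factorial : ℂ) := by
      rw [← Finset.sum_add_distrib]
      refine Finset.sum_congr rfl fun k _ => ?_
      push_cast
      ring
    rw [h2, christoffel_darboux p q p' q' hp hq, sub_self, zero_mul, zero_div, add_zero,
      Nat.factorial_succ, Nat.add_sub_cancel]
    push_cast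
    field_simp

/-- The coefficient of `x^a y^b` in `∑_{k ≤ N} (N! / k!) H_k(x) H_k(y)`. -/
noncomputable def hermiteKernel (N a b : ℕ) : ℂ :=
  ∑ k ∈ Finset.range (N + 1), (N.factorial : ℂ) / k.factorial * (hermiteCoeff k a * hermiteCoeff k b)

/-- The coefficient of `x^a y^b` in `∑_{k ≤ N} (N - k) (N! / k!) H_k(x) H_k(y)`. -/
noncomputable def hermiteWeightedKernel (N a b : ℕ) : ℂ :=
  ∑ k ∈ Finset.range (N + 1),
    ((N : ℂ) - k) * ((N.factorial : ℂ) / k.factorial * (hermiteCoeff k a * hermiteCoeff k b))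

/-- Hermite's equation in x and in y gives, for each k, the factor 2k - a - b; writing 2N = 2k + 2(N
- k) produces the weighted kernel, the counterpart of the gradient product. -/
theorem hermiteKernel_euler (N a b : ℕ) :
    (2 * N - a - b : ℂ) * hermiteKernel N a b =
      -((a + 2) * (a + 1) * hermiteKernel N (a + 2) b) -
        (b + 2) * (b + 1) * hermiteKernel N a (b + 2) + 2 * hermiteWeightedKernel N a b := by
  simp only [hermiteKernel, hermiteWeightedKernel, Finset.mul_sum, ← Finset.sum_neg_distrib,
    ← Finset.sum_sub_distrib, ← Finset.sum_add_distrib]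
  refine Finset.sum_congr rfl fun k _ => ?_
  linear_combination -((N.factorial : ℂ) / k.factorial * hermiteCoeff k b) * hermiteCoeff_ode k a
    - ((N.factorial : ℂ) / k.factorial * hermiteCoeff k a) * hermiteCoeff_ode k b

/-- Coefficientwise, (y - x) W = ∂_x K - ∂_y K for the weighted kernel W: the summed
Christoffel–Darboux identity combined with H_k' = k H_{k-1}. -/
theorem hermiteKernel_cd (N a b : ℕ) :
    ∑ k ∈ Finset.range (N + 1), ((N : ℂ) - k) * ((N.factorial : ℂ) / k.factorial *
        (hermiteCoeff k a * hermiteXCoeff k b - hermiteXCoeff k a * hermiteCoeff k b)) =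
      (a + 1) * hermiteKernel N (a + 1) b - (b + 1) * hermiteKernel N a (b + 1) := by
  have h := congrArg (fun z => (N.factorial : ℂ) * z) (christoffel_darboux_sum
    (fun k => hermiteCoeff k a) (fun k => hermiteCoeff k b) (fun k => hermiteXCoeff k a)
    (fun k => hermiteXCoeff k b) (fun k => hermiteXCoeff_eq k a) (fun k => hermiteXCoeff_eq k b) N)
  simp only [Finset.mul_sum, hermiteKernel, ← Finset.sum_sub_distrib] at h ⊢
  refine (Finset.sum_congr rfl fun k _ => ?_).trans (h.trans (Finset.sum_congr rfl fun k _ => ?_))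
  · ring
  · linear_combination -((N.factorial : ℂ) / k.factorial * hermiteCoeff k b) *
      succ_mul_hermiteCoeff k a
      + ((N.factorial : ℂ) / k.factorial * hermiteCoeff k a) * succ_mul_hermiteCoeff k b

theorem hermiteWeightedKernel_zero (N a : ℕ) :
    hermiteWeightedKernel N a 0 =
      hermiteKernel N (a + 1) 1 - (a + 2) * hermiteKernel N (a + 2) 0 := by
  have h := hermiteKernel_cd N (a + 1) 0
  simp only [hermiteXCoeff_succ, hermiteXCoeff_zero, mul_zero, zero_sub, mul_neg,
    Finset.sum_neg_distrib] at h
  rw [hermiteWeightedKernel]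
  push_cast at h
  linear_combination -h

/-- Moves one degree from y to x, keeping a + b fixed; the same recursion as `expect_gueGrad_succ`,
with `hermiteWeightedKernel_zero` as its start. -/
theorem hermiteWeightedKernel_succ (N a b : ℕ) :
    hermiteWeightedKernel N a (b + 1) = hermiteWeightedKernel N (a + 1) b +
      (b + 2) * hermiteKernel N (a + 1) (b + 2) - (a + 2) * hermiteKernel N (a + 2) (b + 1) := by
  have h := hermiteKernel_cd N (a + 1) (b + 1)
  simp only [hermiteXCoeff_succ, mul_sub, Finset.sum_sub_distrib] at h
  rw [hermiteWeightedKernel, hermiteWeightedKernel]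
  push_cast at h
  linear_combination -h

theorem hermiteCoeff_of_lt {k a : ℕ} (h : k < a) : hermiteCoeff k a = 0 := by
  rw [hermiteCoeff, Polynomial.coeff_hermite_of_lt h, Int.cast_zero]

theorem hermiteCoeff_of_odd {k a : ℕ} (h : Odd (k + a)) : hermiteCoeff k a = 0 := by
  rw [hermiteCoeff, Polynomial.coeff_hermite_of_odd_add h, Int.cast_zero]

theorem hermiteCoeff_explicit (m a : ℕ) :
    hermiteCoeff (2 * m + a) a =
      (-1 / 2) ^ m * ((2 * m + a).factorial / (m.factorial * a.factorial)) := by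
  have h1 : ((2 * m - 1).doubleFactorial : ℂ) * (2 ^ m * m.factorial) = (2 * m).factorial := by
    -- At `m = 0` the truncated `2 * m - 1` is 0, whose double factorial is 1, the value required of
    -- (-1)!!.
    rcases m with _ | m
    · simp
    · have h : (2 * (m + 1) - 1).doubleFactorial * (2 ^ (m + 1) * (m + 1).factorial) =
          (2 * (m + 1)).factorial := by
        rw [← Nat.doubleFactorial_two_mul, show 2 * (m + 1) = 2 * m + 1 + 1 by ring,
          Nat.factorial_eq_mul_doubleFactorial, mul_comm, Nat.add_sub_cancel]
      exact_mod_cast h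
  have h2 : ((2 * m + a).choose a : ℂ) * ((2 * m).factorial * a.factorial) =
      (2 * m + a).factorial := by
    have := Nat.choose_mul_factorial_mul_factorial (Nat.le_add_left a (2 * m))
    rw [Nat.add_sub_cancel] at this
    rw [← this]
    push_cast
    ring
  have hm : (m.factorial : ℂ) ≠ 0 := by exact_mod_cast m.factorial_ne_zero
  have ha : (a.factorial : ℂ) ≠ 0 := by exact_mod_cast a.factorial_ne_zero
  rw [hermiteCoeff, Polynomial.coeff_hermite_explicit, ← h2, ← h1]
  push_cast
  rw [div_pow]
  field_simp

theorem hermiteKernel_comm (N a b : ℕ) : hermiteKernel N a b = hermiteKernel N b a := by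
  simp only [hermiteKernel, mul_comm (hermiteCoeff _ a)]

theorem hermiteKernel_of_lt_left {N a : ℕ} (h : N < a) (b : ℕ) : hermiteKernel N a b = 0 := by
  refine Finset.sum_eq_zero fun k hk => ?_
  rw [hermiteCoeff_of_lt (by grind : k < a)]
  ring

theorem hermiteKernel_of_lt_right {N b : ℕ} (h : N < b) (a : ℕ) : hermiteKernel N a b = 0 := by
  rw [hermiteKernel_comm, hermiteKernel_of_lt_left h]

/-- Only H_N reaches degree N, and it is monic. This case carries the first moments. -/
theorem hermiteKernel_top (N a : ℕ) : hermiteKernel N a N = hermiteCoeff N a := by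
  rw [hermiteKernel, Finset.sum_range_succ, Finset.sum_eq_zero, hermiteCoeff, hermiteCoeff,
    Polynomial.coeff_hermite_self]
  · have : (N.factorial : ℂ) ≠ 0 := by exact_mod_cast N.factorial_ne_zero
    simp [this]
  · intro k hk
    rw [hermiteCoeff_of_lt (Finset.mem_range.mp hk)]
    ring

theorem hermiteKernel_of_odd {N a b : ℕ} (h : Odd (a + b)) : hermiteKernel N a b = 0 := by
  refine Finset.sum_eq_zero fun k _ => ?_
  rcases Nat.even_or_odd (k + a) with h1 | h1
  · rw [hermiteCoeff_of_odd (by grind : Odd (k + b))]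
    ring
  · rw [hermiteCoeff_of_odd h1]
    ring

/-! ### Gaussian moments and integration by parts. -/

theorem integrable_pow_gaussianReal (n : ℕ) :
    Integrable (fun x : ℝ => x ^ n) (gaussianReal 0 1) := by
  have h := (memLp_id_gaussianReal (μ := 0) (v := 1) n).integrable_norm_pow'
  refine (integrable_norm_iff (by fun_prop)).mp ?_
  simpa using h

theorem integrable_gaussianPDFReal_mul_pow (n : ℕ) :
    Integrable (fun x : ℝ => gaussianPDFReal 0 1 x * x ^ n) := by
  have h := integrable_pow_gaussianReal n
  rw [gaussianReal_of_var_ne_zero _ one_ne_zero, integrable_withDensity_iff_integrable_smul'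
    (by fun_prop) (by simp [gaussianPDF])] at h
  refine h.congr (.of_forall fun x => ?_)
  simp [gaussianPDF, ENNReal.toReal_ofReal (gaussianPDFReal_nonneg 0 1 x)]

/-- The moments `m_n` of the standard Gaussian satisfy `m_{n+1} = n m_{n-1}`. -/
theorem integral_pow_succ_gaussianReal (n : ℕ) :
    ∫ x, x ^ (n + 1) ∂gaussianReal 0 1 = n * ∫ x, x ^ (n - 1) ∂gaussianReal 0 1 := by
  -- With φ the density, φ' = -xφ, so (φ x^n)' is the difference of the two integrands, and its
  -- integral over the line is zero.
  have hd : ∀ x : ℝ, HasDerivAt (fun x => gaussianPDFReal 0 1 x * x ^ n)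
      (n * (gaussianPDFReal 0 1 x * x ^ (n - 1)) - gaussianPDFReal 0 1 x * x ^ (n + 1)) x := by
    intro x
    have h1 : HasDerivAt (fun x => gaussianPDFReal 0 1 x) (gaussianPDFReal 0 1 x * (-x)) x := by
      simp only [gaussianPDFReal_def]
      have h2 : HasDerivAt (fun x : ℝ => -(x - 0) ^ 2 / (2 * ((1 : NNReal) : ℝ))) (-x) x := by
        have := (((hasDerivAt_id x).sub_const 0).pow 2).neg.div_const (2 * ((1 : NNReal) : ℝ))
        refine this.congr_deriv ?_
        simp only [id, Nat.add_one_sub_one, pow_one, NNReal.coe_one, sub_zero, Nat.cast_ofNat]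
        ring
      exact (h2.exp.const_mul _).congr_deriv (by ring)
    exact (h1.mul (hasDerivAt_pow n x)).congr_deriv (by ring)
  have h0 := integral_eq_zero_of_hasDerivAt_of_integrable hd
    (((integrable_gaussianPDFReal_mul_pow _).const_mul _).sub
      (integrable_gaussianPDFReal_mul_pow _)) (integrable_gaussianPDFReal_mul_pow _)
  rw [integral_sub ((integrable_gaussianPDFReal_mul_pow _).const_mul _)
    (integrable_gaussianPDFReal_mul_pow _), integral_const_mul] at h0
  simp only [integral_gaussianReal_eq_integral_smul one_ne_zero, smul_eq_mul]
  linarith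

theorem integrable_ofReal_pow_gaussianReal (n : ℕ) :
    Integrable (fun x : ℝ => (x : ℂ) ^ n) (gaussianReal 0 1) := by
  simpa using (integrable_pow_gaussianReal n).ofReal (𝕜 := ℂ)

theorem integral_ofReal_pow_succ_gaussianReal (n : ℕ) :
    ∫ x, (x : ℂ) ^ (n + 1) ∂gaussianReal 0 1 = n * ∫ x, (x : ℂ) ^ (n - 1) ∂gaussianReal 0 1 := by
  have h : ∀ k : ℕ, ∫ x, (x : ℂ) ^ k ∂gaussianReal 0 1 = ((∫ x, x ^ k ∂gaussianReal 0 1 : ℝ) : ℂ) := by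
    intro k
    rw [← integral_complex_ofReal]
    simp
  rw [h, h, integral_pow_succ_gaussianReal]
  push_cast
  rfl

/-- The law of an array of independent standard real Gaussians. -/
noncomputable def gaussianArray (N : ℕ) : Measure (Fin N → Fin N → ℝ) :=
  Measure.pi fun _ => Measure.pi fun _ => gaussianReal 0 1

/-- Evaluation of a polynomial at a real array. -/
noncomputable def evalArray {N : ℕ} (g : Fin N → Fin N → ℝ) :
    MvPolynomial (Fin N × Fin N) ℂ →ₐ[ℂ] ℂ :=
  MvPolynomial.aeval fun k => (g k.1 k.2 : ℂ)

section
variable {N : ℕ}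

theorem evalArray_monomial (g : Fin N → Fin N → ℝ) (s : Fin N × Fin N →₀ ℕ) (a : ℂ) :
    evalArray g (MvPolynomial.monomial s a) = a * ∏ i, ∏ j, (g i j : ℂ) ^ s (i, j) := by
  rw [evalArray, MvPolynomial.aeval_monomial, Finsupp.prod_fintype _ _ (by simp),
    Fintype.prod_prod_type]
  rfl

theorem integrable_prod_pow_gaussianArray (s : Fin N × Fin N → ℕ) :
    Integrable (fun g : Fin N → Fin N → ℝ => ∏ i, ∏ j, (g i j : ℂ) ^ s (i, j)) (gaussianArray N) :=
  Integrable.fintype_prod (f := fun i (h : Fin N → ℝ) => ∏ j, (h j : ℂ) ^ s (i, j)) fun i =>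
    Integrable.fintype_prod (f := fun j (x : ℝ) => (x : ℂ) ^ s (i, j)) fun _ =>
      integrable_ofReal_pow_gaussianReal _

theorem integral_prod_pow_gaussianArray (s : Fin N × Fin N → ℕ) :
    ∫ g : Fin N → Fin N → ℝ, ∏ i, ∏ j, (g i j : ℂ) ^ s (i, j) ∂gaussianArray N =
      ∏ k, ∫ x, (x : ℂ) ^ s k ∂gaussianReal 0 1 := by
  rw [gaussianArray, integral_fintype_prod_eq_prod (fun i (h : Fin N → ℝ) => ∏ j, (h j : ℂ) ^ s (i, j)),
    Fintype.prod_prod_type]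
  exact Finset.prod_congr rfl fun i _ =>
    integral_fintype_prod_eq_prod (fun j (x : ℝ) => (x : ℂ) ^ s (i, j))

theorem integrable_evalArray (P : MvPolynomial (Fin N × Fin N) ℂ) :
    Integrable (fun g => evalArray g P) (gaussianArray N) := by
  induction P using MvPolynomial.induction_on' with
  | monomial s a =>
    simp only [evalArray_monomial]
    exact (integrable_prod_pow_gaussianArray _).const_mul a
  | add p q hp hq =>
    simp only [map_add]
    exact hp.add hq

/-- The expectation of a polynomial in independent standard Gaussians. -/
noncomputable def expect : MvPolynomial (Fin N × Fin N) ℂ →ₗ[ℂ] ℂ where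
  toFun P := ∫ g, evalArray g P ∂gaussianArray N
  map_add' P Q := by
    simp only [map_add]
    exact integral_add (integrable_evalArray P) (integrable_evalArray Q)
  map_smul' a P := by
    simp only [map_smul, RingHom.id_apply]
    exact integral_smul a _

theorem expect_monomial (s : Fin N × Fin N →₀ ℕ) (a : ℂ) :
    expect (MvPolynomial.monomial s a) = a * ∏ k, ∫ x, (x : ℂ) ^ s k ∂gaussianReal 0 1 := by
  change ∫ g, evalArray g _ ∂gaussianArray N = _
  simp only [evalArray_monomial]
  rw [integral_const_mul, integral_prod_pow_gaussianArray]

/-- Gaussian integration by parts. -/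
theorem expect_X_mul (k : Fin N × Fin N) (P : MvPolynomial (Fin N × Fin N) ℂ) :
    expect (MvPolynomial.X k * P) = expect (MvPolynomial.pderiv k P) := by
  induction P using MvPolynomial.induction_on' with
  | monomial s a =>
    rw [MvPolynomial.X, MvPolynomial.monomial_mul, MvPolynomial.pderiv_monomial, expect_monomial,
      expect_monomial,
      ← Finset.mul_prod_erase _ (fun l => ∫ x, (x : ℂ) ^ (Finsupp.single k 1 + s : _ →₀ ℕ) l
        ∂gaussianReal 0 1) (Finset.mem_univ k),
      ← Finset.mul_prod_erase _ (fun l => ∫ x, (x : ℂ) ^ (s - Finsupp.single k 1 : _ →₀ ℕ) l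
        ∂gaussianReal 0 1) (Finset.mem_univ k)]
    have h1 : ∀ l ∈ Finset.univ.erase k, (Finsupp.single k 1 + s : _ →₀ ℕ) l = s l := by
      intro l hl
      simp [(Finset.ne_of_mem_erase hl).symm]
    have h2 : ∀ l ∈ Finset.univ.erase k, (s - Finsupp.single k 1 : _ →₀ ℕ) l = s l := by
      intro l hl
      simp [(Finset.ne_of_mem_erase hl).symm]
    have h3 : ∏ l ∈ Finset.univ.erase k,
        ∫ x, (x : ℂ) ^ (Finsupp.single k 1 + s : _ →₀ ℕ) l ∂gaussianReal 0 1 =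
        ∏ l ∈ Finset.univ.erase k,
          ∫ x, (x : ℂ) ^ (s - Finsupp.single k 1 : _ →₀ ℕ) l ∂gaussianReal 0 1 :=
      Finset.prod_congr rfl fun l hl => by rw [h1 l hl, h2 l hl]
    rw [h3]
    simp only [Finsupp.add_apply, Finsupp.single_eq_same, Finsupp.tsub_apply]
    rw [add_comm 1, integral_ofReal_pow_succ_gaussianReal]
    ring
  | add p q hp hq => rw [mul_add, map_add, map_add, map_add, hp, hq]

theorem expect_one : expect (1 : MvPolynomial (Fin N × Fin N) ℂ) = 1 := by
  have h := expect_monomial (N := N) 0 1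
  simpa using h

theorem expect_euler (P : MvPolynomial (Fin N × Fin N) ℂ) :
    expect (∑ k, MvPolynomial.X k * MvPolynomial.pderiv k P) =
      expect (∑ k, MvPolynomial.pderiv k (MvPolynomial.pderiv k P)) := by
  simp only [map_sum, expect_X_mul]

end

/-! ### The GUE matrix as a matrix of linear forms in Gaussians. -/

section
variable {N : ℕ}

/-- The coefficient of `g i j` in the entry `(i, j)` of the GUE matrix. -/
noncomputable def gueFst (i j : Fin N) : ℂ :=
  if i = j then ((√(N : ℝ) : ℝ) : ℂ)⁻¹
  else if i < j then ((√(2 * N : ℝ) : ℝ) : ℂ)⁻¹ else -Complex.I * ((√(2 * N : ℝ) : ℝ) : ℂ)⁻¹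

/-- The coefficient of `g j i` in the entry `(i, j)` of the GUE matrix, off the diagonal. -/
noncomputable def gueSnd (i j : Fin N) : ℂ :=
  if i = j then 0
  else if i < j then Complex.I * ((√(2 * N : ℝ) : ℝ) : ℂ)⁻¹ else ((√(2 * N : ℝ) : ℝ) : ℂ)⁻¹

theorem ofReal_sqrt_inv_sq (x : ℝ) (hx : 0 ≤ x) :
    ((√x : ℝ) : ℂ)⁻¹ * ((√x : ℝ) : ℂ)⁻¹ = (x : ℂ)⁻¹ := by
  rw [← mul_inv, ← Complex.ofReal_mul, Real.mul_self_sqrt hx]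

theorem gueFst_mul_self (i j : Fin N) :
    gueFst i j * gueFst i j + gueSnd i j * gueSnd i j = if i = j then (N : ℂ)⁻¹ else 0 := by
  have h := ofReal_sqrt_inv_sq N (by positivity)
  rw [gueFst, gueSnd]
  split_ifs
  · linear_combination h
  · linear_combination (((√(2 * N : ℝ) : ℝ) : ℂ)⁻¹ * ((√(2 * N : ℝ) : ℝ) : ℂ)⁻¹) * Complex.I_mul_I
  · linear_combination (((√(2 * N : ℝ) : ℝ) : ℂ)⁻¹ * ((√(2 * N : ℝ) : ℝ) : ℂ)⁻¹) * Complex.I_mul_I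

theorem gueFst_mul_gueSnd (i j : Fin N) :
    gueFst i j * gueSnd j i + gueSnd i j * gueFst j i = if i = j then 0 else (N : ℂ)⁻¹ := by
  have h := ofReal_sqrt_inv_sq (2 * N) (by positivity)
  have h2 : ((2 * N : ℝ) : ℂ)⁻¹ = 2⁻¹ * (N : ℂ)⁻¹ := by
    push_cast
    rw [mul_inv]
  rw [h2] at h
  rcases lt_trichotomy i j with hij | rfl | hij
  · rw [gueFst, gueSnd, gueFst, gueSnd, if_neg hij.ne, if_pos hij, if_neg hij.ne',
      if_neg hij.not_gt, if_neg hij.ne, if_pos hij, if_neg hij.ne', if_neg hij.not_gt,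
      if_neg hij.ne]
    linear_combination 2 * h - (((√(2 * N : ℝ) : ℝ) : ℂ)⁻¹ * ((√(2 * N : ℝ) : ℝ) : ℂ)⁻¹) *
      Complex.I_mul_I
  · simp [gueSnd]
  · rw [gueFst, gueSnd, gueFst, gueSnd, if_neg hij.ne', if_neg hij.not_gt, if_neg hij.ne,
      if_pos hij, if_neg hij.ne', if_neg hij.not_gt, if_neg hij.ne, if_pos hij, if_neg hij.ne']
    linear_combination 2 * h - (((√(2 * N : ℝ) : ℝ) : ℂ)⁻¹ * ((√(2 * N : ℝ) : ℝ) : ℂ)⁻¹) *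
      Complex.I_mul_I

/-- The GUE matrix with entries regarded as linear forms in the underlying Gaussians. -/
noncomputable def gueForm (N : ℕ) : Matrix (Fin N) (Fin N) (MvPolynomial (Fin N × Fin N) ℂ) :=
  Matrix.of fun i j => gueFst i j • MvPolynomial.X (i, j) + gueSnd i j • MvPolynomial.X (j, i)

theorem gueForm_apply (i j : Fin N) : gueForm N i j =
    gueFst i j • MvPolynomial.X (i, j) + gueSnd i j • MvPolynomial.X (j, i) := rfl

theorem gueForm_map_evalArray (g : Fin N → Fin N → ℝ) :
    (gueForm N).map (evalArray g) = gueMatrix N g := by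
  ext i j
  rw [Matrix.map_apply, gueForm_apply, map_add, map_smul, map_smul, evalArray,
    MvPolynomial.aeval_X, MvPolynomial.aeval_X, gueFst, gueSnd, gueMatrix, Matrix.of_apply]
  split_ifs with h
  · subst h
    push_cast
    simp only [smul_eq_mul]
    ring
  · simp only [smul_eq_mul]
    ring
  · simp only [smul_eq_mul]
    ring

theorem pderiv_gueForm (k : Fin N × Fin N) (i j : Fin N) :
    MvPolynomial.pderiv k (gueForm N i j) = MvPolynomial.C
      (gueFst i j * (if k = (i, j) then 1 else 0) + gueSnd i j * (if k = (j, i) then 1 else 0)) := by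
  rw [gueForm_apply, map_add, Derivation.map_smul, Derivation.map_smul,
    MvPolynomial.pderiv_X, MvPolynomial.pderiv_X,
    map_add, map_mul, map_mul, MvPolynomial.smul_eq_C_mul, MvPolynomial.smul_eq_C_mul]
  simp only [Pi.single_apply, eq_comm (a := k)]
  split_ifs <;> simp

theorem pderiv_pderiv_gueForm (k : Fin N × Fin N) (i j : Fin N) :
    MvPolynomial.pderiv k (MvPolynomial.pderiv k (gueForm N i j)) = 0 := by
  rw [pderiv_gueForm, MvPolynomial.pderiv_C]

/-- The gradients of linear forms are constant, and their products are the covariances of the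
entries. Off the diagonal M_ij pairs to zero with itself because its real and imaginary parts have
equal variance. -/
theorem sum_pderiv_gueForm_mul (i j l m : Fin N) :
    ∑ k, MvPolynomial.pderiv k (gueForm N i j) * MvPolynomial.pderiv k (gueForm N l m) =
      if i = m ∧ j = l then MvPolynomial.C (N : ℂ)⁻¹ else 0 := by
  have h : ∑ k : Fin N × Fin N,
      (gueFst i j * (if k = (i, j) then 1 else 0) + gueSnd i j * (if k = (j, i) then 1 else 0)) *
      (gueFst l m * (if k = (l, m) then 1 else 0) + gueSnd l m * (if k = (m, l) then 1 else 0)) =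
        if i = m ∧ j = l then (N : ℂ)⁻¹ else 0 := by
    simp only [add_mul, mul_add, mul_ite, ite_mul, mul_one, mul_zero, zero_mul,
      Finset.sum_add_distrib, Finset.mem_univ, if_true, Finset.sum_ite_eq',
      Prod.mk.injEq]
    have h1 := gueFst_mul_self i j
    have h2 := gueFst_mul_gueSnd i j
    by_cases ha : i = l ∧ j = m
    · obtain ⟨rfl, rfl⟩ := ha
      by_cases hb : i = j
      · subst hb
        simp at h1 h2 ⊢
        linear_combination h1 + h2
      · simp [hb, Ne.symm hb] at h1 ⊢
        linear_combination h1
    · by_cases hb : i = m ∧ j = l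
      · obtain ⟨rfl, rfl⟩ := hb
        have hc : i ≠ j := fun h => ha ⟨h, h.symm⟩
        simp [hc, hc.symm] at h2 ⊢
        linear_combination h2
      · have ha' : ¬(j = m ∧ i = l) := fun h => ha h.symm
        have hb' : ¬(j = l ∧ i = m) := fun h => hb h.symm
        simp [ha, hb, ha', hb', eq_comm (a := l), eq_comm (a := m)]
  simp only [pderiv_gueForm, ← map_mul, ← map_sum, h]
  split_ifs <;> simp

theorem sum_X_mul_pderiv_gueForm (i j : Fin N) :
    ∑ k, MvPolynomial.X k * MvPolynomial.pderiv k (gueForm N i j) = gueForm N i j := by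
  simp only [pderiv_gueForm, map_add, apply_ite (MvPolynomial.C (σ := Fin N × Fin N)), map_zero,
    mul_add, mul_ite, mul_one, mul_zero, Finset.sum_add_distrib,
    Finset.sum_ite_eq', Finset.mem_univ, if_true]
  rw [gueForm_apply, MvPolynomial.smul_eq_C_mul, MvPolynomial.smul_eq_C_mul, mul_comm,
    mul_comm (MvPolynomial.X (j, i))]

/-- The coefficient of `t^a` in `det (t - M)`, as a polynomial in the underlying Gaussians. -/
noncomputable def gueCoeff (N a : ℕ) : MvPolynomial (Fin N × Fin N) ℂ :=
  (gueForm N).charpoly.coeff a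

theorem evalArray_gueCoeff (g : Fin N → Fin N → ℝ) (a : ℕ) :
    evalArray g (gueCoeff N a) = (gueMatrix N g).charpoly.coeff a := by
  have h := Matrix.charpoly_map (gueForm N) (evalArray g).toRingHom
  have h2 : (gueForm N).map (evalArray g).toRingHom = gueMatrix N g := gueForm_map_evalArray g
  rw [h2] at h
  rw [h, Polynomial.coeff_map]
  rfl

theorem gueCoeff_of_lt {a : ℕ} (h : N < a) : gueCoeff N a = 0 := by
  refine Polynomial.coeff_eq_zero_of_natDegree_lt ?_
  rwa [Matrix.charpoly_natDegree_eq_dim, Fintype.card_fin]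

theorem gueCoeff_self : gueCoeff N N = 1 := by
  have h := (gueForm N).charpoly_monic
  rwa [Polynomial.Monic, Polynomial.leadingCoeff, Matrix.charpoly_natDegree_eq_dim,
    Fintype.card_fin] at h

theorem sum_pderiv_pderiv_gueCoeff (a : ℕ) :
    ∑ k, MvPolynomial.pderiv k (MvPolynomial.pderiv k (gueCoeff N a)) =
      -((N : ℂ)⁻¹ • ((a + 2) * (a + 1) * gueCoeff N (a + 2))) := by
  rw [MvPolynomial.smul_eq_C_mul]
  exact sum_map_map_charpoly_coeff (gueForm N) (d := MvPolynomial.pderiv) sum_pderiv_gueForm_mul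
    pderiv_pderiv_gueForm a

theorem sum_X_mul_pderiv_gueCoeff (a : ℕ) :
    ∑ k, MvPolynomial.X k * MvPolynomial.pderiv k (gueCoeff N a) =
      (N - a) * gueCoeff N a := by
  have h := sum_mul_map_charpoly_coeff (gueForm N) (d := MvPolynomial.pderiv) MvPolynomial.X
    sum_X_mul_pderiv_gueForm a
  rwa [Fintype.card_fin] at h

/-- The inner product of the gradients of two coefficients of the characteristic polynomial. -/
noncomputable def gueGrad (N a b : ℕ) : MvPolynomial (Fin N × Fin N) ℂ :=
  ∑ k, MvPolynomial.pderiv k (gueCoeff N a) * MvPolynomial.pderiv k (gueCoeff N b)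

theorem gueGrad_eq (a b : ℕ) : gueGrad N a b =
    (N : ℂ)⁻¹ • (adjCoeff (gueForm N) a * adjCoeff (gueForm N) b).trace := by
  rw [MvPolynomial.smul_eq_C_mul]
  exact sum_map_charpoly_coeff_mul (gueForm N) (d := MvPolynomial.pderiv) sum_pderiv_gueForm_mul a b

theorem gueGrad_zero (a : ℕ) : gueGrad N a 0 = (N : ℂ)⁻¹ •
    (gueCoeff N (a + 1) * gueCoeff N 1 - (a + 2) * (gueCoeff N (a + 2) * gueCoeff N 0)) := by
  have h := trace_adjXCoeff_mul_adjCoeff (gueForm N) (a + 1) 0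
  rw [adjXCoeff_succ, adjXCoeff_zero, Matrix.mul_zero, Matrix.trace_zero, sub_zero] at h
  rw [gueGrad_eq, h]
  simp only [gueCoeff]
  push_cast
  ring_nf

/-- Iterated down to `gueGrad_zero`, this writes every gradient product through products of
coefficients of index sum a + b + 2, so that the recursion for moments closes. -/
theorem gueGrad_succ (a b : ℕ) : gueGrad N a (b + 1) = gueGrad N (a + 1) b + (N : ℂ)⁻¹ •
    ((b + 2) * (gueCoeff N (a + 1) * gueCoeff N (b + 2)) -
      (a + 2) * (gueCoeff N (a + 2) * gueCoeff N (b + 1))) := by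
  have h := eq_add_of_sub_eq (trace_adjXCoeff_mul_adjCoeff (gueForm N) (a + 1) (b + 1))
  rw [adjXCoeff_succ, adjXCoeff_succ] at h
  rw [gueGrad_eq, gueGrad_eq, h, ← smul_add]
  simp only [gueCoeff]
  push_cast
  ring_nf

theorem gue_euler (a b : ℕ) :
    ∑ k, MvPolynomial.X k * MvPolynomial.pderiv k (gueCoeff N a * gueCoeff N b) =
      (2 * N - a - b) * (gueCoeff N a * gueCoeff N b) := by
  have h : ∑ k, MvPolynomial.X k * MvPolynomial.pderiv k (gueCoeff N a * gueCoeff N b) =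
      gueCoeff N a * ∑ k, MvPolynomial.X k * MvPolynomial.pderiv k (gueCoeff N b) +
      gueCoeff N b * ∑ k, MvPolynomial.X k * MvPolynomial.pderiv k (gueCoeff N a) := by
    rw [Finset.mul_sum, Finset.mul_sum, ← Finset.sum_add_distrib]
    refine Finset.sum_congr rfl fun k _ => ?_
    rw [Derivation.leibniz, smul_eq_mul, smul_eq_mul]
    ring
  rw [h, sum_X_mul_pderiv_gueCoeff, sum_X_mul_pderiv_gueCoeff]
  ring

theorem gue_laplacian (a b : ℕ) :
    ∑ k, MvPolynomial.pderiv k (MvPolynomial.pderiv k (gueCoeff N a * gueCoeff N b)) =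
      -((N : ℂ)⁻¹ • ((a + 2) * (a + 1) * (gueCoeff N (a + 2) * gueCoeff N b))) -
      (N : ℂ)⁻¹ • ((b + 2) * (b + 1) * (gueCoeff N a * gueCoeff N (b + 2))) +
      2 * gueGrad N a b := by
  have h : ∑ k, MvPolynomial.pderiv k (MvPolynomial.pderiv k (gueCoeff N a * gueCoeff N b)) =
      gueCoeff N a * ∑ k, MvPolynomial.pderiv k (MvPolynomial.pderiv k (gueCoeff N b)) +
      gueCoeff N b * ∑ k, MvPolynomial.pderiv k (MvPolynomial.pderiv k (gueCoeff N a)) +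
      2 * gueGrad N a b := by
    rw [gueGrad, Finset.mul_sum, Finset.mul_sum, Finset.mul_sum, ← Finset.sum_add_distrib,
      ← Finset.sum_add_distrib]
    refine Finset.sum_congr rfl fun k _ => ?_
    simp only [Derivation.leibniz, smul_eq_mul, map_add]
    ring
  rw [h, sum_pderiv_pderiv_gueCoeff, sum_pderiv_pderiv_gueCoeff]
  simp only [MvPolynomial.smul_eq_C_mul]
  ring

end

/-! ### Mixed moments equal Hermite kernel coefficients. -/

section
variable {N : ℕ}

theorem expect_C_mul (z : ℂ) (P : MvPolynomial (Fin N × Fin N) ℂ) :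
    expect (MvPolynomial.C z * P) = z * expect P := by
  rw [← MvPolynomial.smul_eq_C_mul, map_smul, smul_eq_mul]

/-- The mixed moment of two coefficients of the characteristic polynomial. -/
noncomputable def gueMoment (N a b : ℕ) : ℂ := expect (gueCoeff N a * gueCoeff N b)

theorem gueMoment_euler (a b : ℕ) :
    (2 * N - a - b : ℂ) * gueMoment N a b =
      -((N : ℂ)⁻¹ * ((a + 2) * (a + 1) * gueMoment N (a + 2) b)) -
        (N : ℂ)⁻¹ * ((b + 2) * (b + 1) * gueMoment N a (b + 2)) +
        2 * expect (gueGrad N a b) := by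
  have h1 : (2 * N - a - b : MvPolynomial (Fin N × Fin N) ℂ) =
      MvPolynomial.C (2 * N - a - b : ℂ) := by
    simp only [map_sub, map_mul, map_natCast, map_ofNat]
  have h2 : ∀ m : ℕ, ((m + 2) * (m + 1) : MvPolynomial (Fin N × Fin N) ℂ) =
      MvPolynomial.C ((m + 2) * (m + 1) : ℂ) := fun m => by
    simp only [map_add, map_mul, map_natCast, map_ofNat, map_one]
  have h3 : (2 : MvPolynomial (Fin N × Fin N) ℂ) = MvPolynomial.C (2 : ℂ) :=
    (map_ofNat MvPolynomial.C 2).symm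
  have h := expect_euler (gueCoeff N a * gueCoeff N b)
  rw [gue_euler, gue_laplacian, h1, h2, h2, h3, map_add expect, map_sub expect,
    map_neg expect, map_smul, map_smul, expect_C_mul, expect_C_mul, expect_C_mul, expect_C_mul] at h
  exact h

theorem expect_gueGrad_zero (a : ℕ) : expect (gueGrad N a 0) =
    (N : ℂ)⁻¹ * gueMoment N (a + 1) 1 - (a + 2) * ((N : ℂ)⁻¹ * gueMoment N (a + 2) 0) := by
  have h2 : (a + 2 : MvPolynomial (Fin N × Fin N) ℂ) = MvPolynomial.C (a + 2 : ℂ) := by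
    simp only [map_add, map_natCast, map_ofNat]
  rw [gueGrad_zero, map_smul, map_sub, h2, expect_C_mul, smul_eq_mul, gueMoment, gueMoment]
  ring

theorem expect_gueGrad_succ (a b : ℕ) : expect (gueGrad N a (b + 1)) =
    expect (gueGrad N (a + 1) b) + (b + 2) * ((N : ℂ)⁻¹ * gueMoment N (a + 1) (b + 2)) -
      (a + 2) * ((N : ℂ)⁻¹ * gueMoment N (a + 2) (b + 1)) := by
  have h2 : ∀ m : ℕ, (m + 2 : MvPolynomial (Fin N × Fin N) ℂ) = MvPolynomial.C (m + 2 : ℂ) :=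
    fun m => by simp only [map_add, map_natCast, map_ofNat]
  rw [gueGrad_succ, map_add, map_smul, map_sub, h2, h2, expect_C_mul, expect_C_mul, smul_eq_mul,
    gueMoment, gueMoment]
  ring

theorem gueMoment_of_lt {a b : ℕ} (h : N < a ∨ N < b) : gueMoment N a b = 0 := by
  rw [gueMoment]
  rcases h with h | h
  · rw [gueCoeff_of_lt h, zero_mul, map_zero]
  · rw [gueCoeff_of_lt h, mul_zero, map_zero]

theorem hermiteKernel_of_lt {a b : ℕ} (h : N < a ∨ N < b) : hermiteKernel N a b = 0 := by
  rcases h with h | h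
  · exact hermiteKernel_of_lt_left h b
  · exact hermiteKernel_of_lt_right h a

/-- The mixed moments of the coefficients of the characteristic polynomial of a GUE matrix are
the coefficients of the Hermite kernel. -/
theorem gueMoment_eq (n : ℕ) : ∀ a b : ℕ, a + b + n = 2 * N →
    gueMoment N a b = ((√(N : ℝ) : ℝ) : ℂ)⁻¹ ^ n * hermiteKernel N a b := by
  induction n using Nat.strong_induction_on with
  | _ n ih =>
    intro a b hab
    rcases Nat.eq_zero_or_pos n with rfl | hn
    · by_cases h : N < a ∨ N < b
      · rw [gueMoment_of_lt h, hermiteKernel_of_lt h, mul_zero]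
      · have ha : a = N := by omega
        have hb : b = N := by omega
        subst ha hb
        rw [gueMoment, gueCoeff_self, one_mul, expect_one, hermiteKernel_top, hermiteCoeff,
          Polynomial.coeff_hermite_self]
        simp
    · have hc : ((√(N : ℝ) : ℝ) : ℂ)⁻¹ * ((√(N : ℝ) : ℝ) : ℂ)⁻¹ = (N : ℂ)⁻¹ :=
        ofReal_sqrt_inv_sq N (by positivity)
      -- Moments of index sum larger by two have degree n - 2, and 1/N supplies the two missing
      -- factors 1/√N. If n = 1, some index exceeds N and both sides vanish.
      have hs : ∀ a b : ℕ, a + b + n = 2 * N + 2 → (N : ℂ)⁻¹ * gueMoment N a b =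
          ((√(N : ℝ) : ℝ) : ℂ)⁻¹ ^ n * hermiteKernel N a b := by
        intro a b hab
        by_cases h : N < a ∨ N < b
        · rw [gueMoment_of_lt h, hermiteKernel_of_lt h, mul_zero, mul_zero]
        · obtain ⟨m, rfl⟩ : ∃ m, n = m + 2 := ⟨n - 2, by omega⟩
          rw [ih m (by omega) a b (by omega), ← hc]
          ring
      -- Induction on b with a free, since the recursion trades (a, b + 1) for (a + 1, b).
      have hg : ∀ b a : ℕ, a + b + n = 2 * N → expect (gueGrad N a b) =
          ((√(N : ℝ) : ℝ) : ℂ)⁻¹ ^ n * hermiteWeightedKernel N a b := by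
        intro b
        induction b with
        | zero =>
          intro a hab
          rw [expect_gueGrad_zero, hs _ _ (by omega), hs _ _ (by omega),
            hermiteWeightedKernel_zero]
          ring
        | succ b ihb =>
          intro a hab
          rw [expect_gueGrad_succ, ihb _ (by omega), hs _ _ (by omega), hs _ _ (by omega),
            hermiteWeightedKernel_succ]
          ring
      have h1 := gueMoment_euler (N := N) a b
      have h2 := hermiteKernel_euler N a b
      have h3 : (2 * N - a - b : ℂ) = n := by
        have : ((a + b + n : ℕ) : ℂ) = ((2 * N : ℕ) : ℂ) := by rw [hab]
        push_cast at this
        linear_combination -this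
      have h4 : (n : ℂ) ≠ 0 := by exact_mod_cast hn.ne'
      rw [h3] at h1 h2
      refine mul_left_cancel₀ h4 ?_
      linear_combination h1 - ((√(N : ℝ) : ℝ) : ℂ)⁻¹ ^ n * h2 + 2 * hg b a hab
        - (a + 2) * (a + 1) * hs (a + 2) b (by omega) - (b + 2) * (b + 1) * hs a (b + 2) (by omega)

theorem gueMoment_sub_sub {r s : ℕ} (hr : r ≤ N) (hs : s ≤ N) :
    gueMoment N (N - r) (N - s) =
      ((√(N : ℝ) : ℝ) : ℂ)⁻¹ ^ (r + s) * hermiteKernel N (N - r) (N - s) :=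
  gueMoment_eq (r + s) _ _ (by omega)

/-! ### Moments of secular coefficients. -/

/-- The secular coefficients as polynomials in the underlying Gaussians. -/
noncomputable def gueSecular (N r : ℕ) : MvPolynomial (Fin N × Fin N) ℂ :=
  if r ≤ N then (-1) ^ r * gueCoeff N (N - r) else 0

theorem secular_gueMatrix (r : ℕ) (g : Fin N → Fin N → ℝ) :
    secular r (gueMatrix N g) = evalArray g (gueSecular N r) := by
  rw [secular, gueSecular]
  split_ifs <;> simp [evalArray_gueCoeff]

theorem measurable_secular (r : ℕ) :
    Measurable fun M : Matrix (Fin N) (Fin N) ℂ => secular r M := by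
  have h : ∀ a, Measurable fun M : Matrix (Fin N) (Fin N) ℂ => M.charpoly.coeff a := by
    intro a
    -- The universal characteristic polynomial exhibits the coefficient as a polynomial in the
    -- entries.
    have h1 : ∀ M : Matrix (Fin N) (Fin N) ℂ, M.charpoly.coeff a =
        MvPolynomial.eval (fun k : Fin N × Fin N => M k.1 k.2)
          ((Matrix.charpoly.univ ℂ (Fin N)).coeff a) := by
      intro M
      exact (Matrix.charpoly.univ_coeff_eval₂Hom (Fin N) (RingHom.id ℂ)
        (fun k => M k.1 k.2) a).symm
    simp only [h1, MvPolynomial.eval_eq']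
    refine Finset.measurable_fun_sum _ fun d _ =>
      (Finset.measurable_fun_prod _ fun k _ => ?_).const_mul _
    exact ((measurable_pi_apply k.2).comp (measurable_pi_apply k.1)).pow_const _
  simp only [secular]
  split_ifs
  · exact (h _).const_mul _
  · exact measurable_const

theorem gueMeasure_eq_map : gueMeasure N = (gaussianArray N).map (gueMatrix N) := rfl

theorem integrable_gueMeasure_of_eval {f : Matrix (Fin N) (Fin N) ℂ → ℂ} (hf : Measurable f)
    {P : MvPolynomial (Fin N × Fin N) ℂ} (h : ∀ g, f (gueMatrix N g) = evalArray g P) :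
    Integrable f (gueMeasure N) := by
  rw [gueMeasure_eq_map, integrable_map_measure hf.aestronglyMeasurable
    (measurable_gueMatrix N).aemeasurable]
  exact (integrable_evalArray P).congr (.of_forall fun g => (h g).symm)

theorem integral_gueMeasure_of_eval {f : Matrix (Fin N) (Fin N) ℂ → ℂ} (hf : Measurable f)
    {P : MvPolynomial (Fin N × Fin N) ℂ} (h : ∀ g, f (gueMatrix N g) = evalArray g P) :
    ∫ M, f M ∂gueMeasure N = expect P := by
  rw [gueMeasure_eq_map, integral_map (measurable_gueMatrix N).aemeasurable
    hf.aestronglyMeasurable]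
  exact integral_congr_ae (.of_forall h)

theorem integrable_secular (r : ℕ) :
    Integrable (fun M : Matrix (Fin N) (Fin N) ℂ => secular r M) (gueMeasure N) :=
  integrable_gueMeasure_of_eval (measurable_secular r) (secular_gueMatrix r)

theorem secular_mul_secular_gueMatrix (r s : ℕ) (g : Fin N → Fin N → ℝ) :
    secular r (gueMatrix N g) * secular s (gueMatrix N g) =
      evalArray g (gueSecular N r * gueSecular N s) := by
  rw [map_mul, secular_gueMatrix, secular_gueMatrix]

theorem integrable_secular_mul_secular (r s : ℕ) :
    Integrable (fun M : Matrix (Fin N) (Fin N) ℂ => secular r M * secular s M) (gueMeasure N) :=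
  integrable_gueMeasure_of_eval ((measurable_secular r).mul (measurable_secular s))
    (secular_mul_secular_gueMatrix r s)

theorem integral_secular_mul_secular {r s : ℕ} (hr : r ≤ N) (hs : s ≤ N) :
    ∫ M : Matrix (Fin N) (Fin N) ℂ, secular r M * secular s M ∂gueMeasure N =
      (-1) ^ (r + s) * (((√(N : ℝ) : ℝ) : ℂ)⁻¹ ^ (r + s) * hermiteKernel N (N - r) (N - s)) := by
  rw [integral_gueMeasure_of_eval (f := fun M => secular r M * secular s M)
    ((measurable_secular r).mul (measurable_secular s)) (secular_mul_secular_gueMatrix r s),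
    ← gueMoment_sub_sub hr hs, gueMoment, ← expect_C_mul,
    gueSecular, gueSecular, if_pos hr, if_pos hs]
  congr 1
  simp only [map_pow, map_neg, map_one]
  ring

theorem secular_of_lt {r : ℕ} (h : N < r) (M : Matrix (Fin N) (Fin N) ℂ) : secular r M = 0 :=
  if_neg h.not_ge

theorem secular_zero (M : Matrix (Fin N) (Fin N) ℂ) : secular 0 M = 1 := by
  have h := M.charpoly_monic
  rw [Polynomial.Monic, Polynomial.leadingCoeff, Matrix.charpoly_natDegree_eq_dim,
    Fintype.card_fin] at h
  simp [secular, h]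

theorem integral_secular {r : ℕ} (hr : r ≤ N) :
    ∫ M : Matrix (Fin N) (Fin N) ℂ, secular r M ∂gueMeasure N =
      (-1) ^ r * (((√(N : ℝ) : ℝ) : ℂ)⁻¹ ^ r * hermiteCoeff N (N - r)) := by
  have h := integral_secular_mul_secular hr (Nat.zero_le N)
  simpa only [secular_zero, mul_one, add_zero, Nat.sub_zero, hermiteKernel_top] using h

theorem integral_secular_mul_secular_of_odd {r s : ℕ} (h : Odd (r + s)) :
    ∫ M : Matrix (Fin N) (Fin N) ℂ, secular r M * secular s M ∂gueMeasure N = 0 := by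
  by_cases hrs : N < r ∨ N < s
  · rcases hrs with h1 | h1 <;> simp [secular_of_lt h1]
  · have hr : r ≤ N := by omega
    have hs : s ≤ N := by omega
    rw [integral_secular_mul_secular hr hs, hermiteKernel_of_odd (by grind), mul_zero, mul_zero]

theorem integral_secular_of_odd {r : ℕ} (h : Odd r) :
    ∫ M : Matrix (Fin N) (Fin N) ℂ, secular r M ∂gueMeasure N = 0 := by
  have h1 := integral_secular_mul_secular_of_odd (N := N) (r := r) (s := 0) h
  simpa only [secular_zero, mul_one] using h1

/-! ### Closed formulas. -/

theorem sqrt_inv_pow_two_mul (N m : ℕ) :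
    ((√(N : ℝ) : ℝ) : ℂ)⁻¹ ^ (2 * m) = ((N : ℂ)⁻¹) ^ m := by
  rw [pow_mul, pow_two, ofReal_sqrt_inv_sq N (by positivity), Complex.ofReal_natCast]

/-- The Hermite kernel as a sum over the indices of the right parity. -/
theorem hermiteKernel_explicit {a b e r s : ℕ} (hr : 2 * r + e + a = N) (hs : 2 * s + e + b = N)
    (he : e ≤ 1) :
    hermiteKernel N a b = (-1 / 2) ^ (r + s) * ∑ j ∈ Finset.range (min r s + 1),
      (2 : ℂ) ^ (2 * j) / (((r - j).factorial : ℂ) * ((s - j).factorial : ℂ)) *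
        ((N.factorial * (N - 2 * j - e).factorial) / (a.factorial * b.factorial)) := by
  have h1 : hermiteKernel N a b = ∑ j ∈ Finset.range (min r s + 1),
      (N.factorial : ℂ) / (N - 2 * j - e).factorial *
        (hermiteCoeff (N - 2 * j - e) a * hermiteCoeff (N - 2 * j - e) b) := by
    symm
    refine Finset.sum_of_injOn (fun j => N - 2 * j - e) ?_ ?_ ?_ ?_
    · intro i hi j hj hij
      simp only [Finset.coe_range, Set.mem_Iio] at hi hj hij
      omega
    · intro j hj
      simp only [Finset.coe_range, Set.mem_Iio] at hj ⊢
      omega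
    · intro k hk hk2
      rcases Nat.even_or_odd (k + a) with h | h
      · by_cases h3 : k < a ∨ k < b
        · rcases h3 with h3 | h3 <;> rw [hermiteCoeff_of_lt h3] <;> ring
        · refine absurd ?_ hk2
          obtain ⟨m, hm⟩ := h
          have hk3 := Finset.mem_range.mp hk
          simp only [Finset.coe_range, Set.mem_image, Set.mem_Iio]
          -- Solves k = N - 2j - e for j; the division is exact because k, a and N - e have the same
          -- parity.
          exact ⟨(N - e - k) / 2, by omega, by omega⟩
      · rw [hermiteCoeff_of_odd h]
        ring
    · intro j _
      rfl
  rw [h1, Finset.mul_sum]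
  refine Finset.sum_congr rfl fun j hj => ?_
  have hj' := Finset.mem_range.mp hj
  obtain ⟨m, rfl⟩ : ∃ m, r = m + j := ⟨r - j, by omega⟩
  obtain ⟨l, rfl⟩ : ∃ l, s = l + j := ⟨s - j, by omega⟩
  have ha := hermiteCoeff_explicit m a
  have hb := hermiteCoeff_explicit l b
  rw [show 2 * m + a = N - 2 * j - e by omega] at ha
  rw [show 2 * l + b = N - 2 * j - e by omega] at hb
  rw [ha, hb, Nat.add_sub_cancel, Nat.add_sub_cancel]
  have hf : ∀ n : ℕ, (n.factorial : ℂ) ≠ 0 := fun n => by exact_mod_cast n.factorial_ne_zero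
  -- The two Hermite coefficients carry (-1/2)^((r-j)+(s-j)); extracting (-1/2)^(r+s) leaves the
  -- factor 2^(2j).
  have h2 : (-1 / 2 : ℂ) ^ (m + j + (l + j)) * 2 ^ (2 * j) = (-1 / 2) ^ m * (-1 / 2) ^ l := by
    have h3 : (-1 / 2 : ℂ) ^ (2 * j) * 2 ^ (2 * j) = 1 := by
      rw [← mul_pow, pow_mul]
      norm_num
    rw [show m + j + (l + j) = m + l + 2 * j by ring, pow_add, mul_assoc, h3, mul_one, pow_add]
  have := hf (N - 2 * j - e)
  have := hf m
  have := hf l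
  have := hf a
  have := hf b
  calc _ = (-1 / 2 : ℂ) ^ m * (-1 / 2) ^ l *
        (N.factorial * (N - 2 * j - e).factorial /
          (m.factorial * l.factorial * (a.factorial * b.factorial))) := by field_simp
    _ = _ := by
      rw [← h2]
      field_simp

theorem scaledHermite_eq_sum (t : ℂ) (hN : 1 ≤ N) : scaledHermite N N t =
    ∑ j ∈ Finset.range (N + 1),
      ((√(N : ℝ) : ℝ) : ℂ)⁻¹ ^ j * hermiteCoeff N (N - j) * t ^ (N - j) := by
  have hc : ((√(N : ℝ) : ℝ) : ℂ) ≠ 0 := by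
    rw [Complex.ofReal_ne_zero]
    positivity
  rw [scaledHermite, Polynomial.aeval_eq_sum_range, Polynomial.natDegree_hermite,
    ← Finset.sum_range_reflect, Finset.mul_sum]
  refine Finset.sum_congr rfl fun j hj => ?_
  have hj' : j ≤ N := Nat.lt_succ_iff.mp (Finset.mem_range.mp hj)
  have h : (((√(N : ℝ) : ℝ) : ℂ) ^ N) = ((√(N : ℝ) : ℝ) : ℂ) ^ j * ((√(N : ℝ) : ℝ) : ℂ) ^ (N - j) := by
    rw [← pow_add, Nat.add_sub_cancel' hj']
  rw [show N + 1 - 1 - j = N - j by omega, h, zsmul_eq_mul, mul_pow, hermiteCoeff, inv_pow]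
  field_simp

theorem sum_range_of_odd_eq_zero (f : ℕ → ℂ) (hf : ∀ j, Odd j → f j = 0) (n : ℕ) :
    ∑ j ∈ Finset.range (n + 1), f j = ∑ j ∈ Finset.range (n / 2 + 1), f (2 * j) := by
  symm
  refine Finset.sum_of_injOn (fun j => 2 * j) ?_ ?_ ?_ ?_
  · intro i _ j _ hij
    exact Nat.eq_of_mul_eq_mul_left two_pos hij
  · intro j hj
    simp only [Finset.coe_range, Set.mem_Iio] at hj ⊢
    omega
  · intro k hk hk2
    refine hf k (Nat.not_even_iff_odd.mp fun h => hk2 ?_)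
    obtain ⟨m, rfl⟩ := h
    have hk3 := Finset.mem_range.mp hk
    simp only [Finset.coe_range, Set.mem_image, Set.mem_Iio]
    exact ⟨m, by omega, by omega⟩
  · intro j _
    rfl

end

theorem mainTheorem5 (N : ℕ) (hN : 1 ≤ N) :
    -- all first and second moments exist
    (∀ r : ℕ, Integrable (fun M => secular r M) (gueMeasure N)) ∧
    (∀ r s : ℕ, Integrable (fun M => secular r M * secular s M) (gueMeasure N)) ∧
    -- first moments
    (∀ r : ℕ, Odd r → ∫ M, secular r M ∂(gueMeasure N) = 0) ∧
    (∀ r : ℕ, Even r → r ≤ N →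
      ∫ M, secular r M ∂(gueMeasure N) =
        (-1) ^ (r / 2) * ((N.factorial : ℂ) /
          ((2 * (N : ℂ)) ^ (r / 2) * ((r / 2).factorial : ℂ) * ((N - r).factorial : ℂ)))) ∧
    -- expected characteristic polynomial
    (∀ t : ℂ, Integrable (fun M => (Matrix.scalar (Fin N) t - M).det) (gueMeasure N) ∧
      ∫ M, (Matrix.scalar (Fin N) t - M).det ∂(gueMeasure N) =
        ∑ j ∈ Finset.range (N / 2 + 1),
          (∫ M, secular (2 * j) M ∂(gueMeasure N)) * t ^ (N - 2 * j) ∧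
      ∫ M, (Matrix.scalar (Fin N) t - M).det ∂(gueMeasure N) = scaledHermite N N t) ∧
    -- mixed even-odd second moments
    (∀ j k : ℕ, ∫ M, secular (2 * j) M * secular (2 * k + 1) M ∂(gueMeasure N) = 0) ∧
    -- even-even second moments
    (∀ r s : ℕ, 2 * r ≤ N → 2 * s ≤ N →
      ∫ M, secular (2 * r) M * secular (2 * s) M ∂(gueMeasure N) =
        (-(1 / (2 * (N : ℂ)))) ^ (r + s) *
          ∑ j ∈ Finset.range (min r s + 1),
            (2 : ℂ) ^ (2 * j) / (((r - j).factorial : ℂ) * ((s - j).factorial : ℂ)) *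
              (((N.factorial : ℂ) * ((N - 2 * j).factorial : ℂ)) /
                (((N - 2 * r).factorial : ℂ) * ((N - 2 * s).factorial : ℂ)))) ∧
    -- odd-odd second moments
    (∀ r s : ℕ, 2 * r + 1 ≤ N → 2 * s + 1 ≤ N →
      ∫ M, secular (2 * r + 1) M * secular (2 * s + 1) M ∂(gueMeasure N) =
        (-(1 / (2 * (N : ℂ)))) ^ (r + s) *
          ∑ j ∈ Finset.range (min r s + 1),
            (2 : ℂ) ^ (2 * j) / (((r - j).factorial : ℂ) * ((s - j).factorial : ℂ)) *
              ((((N - 1).factorial : ℂ) * ((N - 2 * j - 1).factorial : ℂ)) /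
                (((N - 2 * r - 1).factorial : ℂ) * ((N - 2 * s - 1).factorial : ℂ)))) := by
  refine ⟨integrable_secular, integrable_secular_mul_secular, fun r => integral_secular_of_odd,
    ?_, ?_, fun j k => integral_secular_mul_secular_of_odd (by grind), ?_, ?_⟩
  · rintro r ⟨m, rfl⟩ hr
    have h := hermiteCoeff_explicit m (N - 2 * m)
    rw [show 2 * m + (N - 2 * m) = N by omega] at h
    rw [show m + m = 2 * m by ring, integral_secular (by omega), h, sqrt_inv_pow_two_mul,
      Nat.mul_div_cancel_left m two_pos, Even.neg_one_pow ⟨m, by ring⟩, one_mul, div_pow, mul_pow,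
      inv_pow, div_mul_div_comm, inv_mul_eq_div, div_div, mul_div_assoc']
    congr 1
    ring
  · intro t
    have h1 : ∀ j, Integrable (fun M : Matrix (Fin N) (Fin N) ℂ =>
        (-1) ^ j * secular j M * t ^ (N - j)) (gueMeasure N) := fun j =>
      ((integrable_secular j).const_mul _).mul_const _
    have h2 : ∫ M, (Matrix.scalar (Fin N) t - M).det ∂(gueMeasure N) =
        ∑ j ∈ Finset.range (N + 1),
          (-1) ^ j * (∫ M : Matrix (Fin N) (Fin N) ℂ, secular j M ∂gueMeasure N) * t ^ (N - j) := by
      simp only [det_sub_eq_sum_secular]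
      rw [integral_finsetSum _ fun j _ => h1 j]
      refine Finset.sum_congr rfl fun j _ => ?_
      rw [integral_mul_const, integral_const_mul]
    refine ⟨?_, ?_, ?_⟩
    · simp only [det_sub_eq_sum_secular]
      exact integrable_finsetSum _ fun j _ => h1 j
    · rw [h2, sum_range_of_odd_eq_zero _ fun j hj => by
        rw [integral_secular_of_odd hj, mul_zero, zero_mul]]
      refine Finset.sum_congr rfl fun j _ => ?_
      rw [Even.neg_one_pow ⟨j, by ring⟩, one_mul]
    · rw [h2, scaledHermite_eq_sum t hN]
      refine Finset.sum_congr rfl fun j hj => ?_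
      rw [integral_secular (Nat.lt_succ_iff.mp (Finset.mem_range.mp hj)), ← mul_assoc, ← pow_add,
        Even.neg_one_pow ⟨j, rfl⟩, one_mul]
  · intro r s hr hs
    rw [integral_secular_mul_secular hr hs, ← mul_add, Even.neg_one_pow ⟨r + s, by ring⟩, one_mul,
      sqrt_inv_pow_two_mul, hermiteKernel_explicit (e := 0) (r := r) (s := s) (by omega) (by omega)
      (by omega), ← mul_assoc, ← mul_pow]
    congr 2
    ring
  · intro r s hr hs
    have hN0 : (N : ℂ) ≠ 0 := by exact_mod_cast (by omega : N ≠ 0)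
    -- The total degree is 2(r + s + 1), so one power of 1/N is left over, and it lowers N! to (N -
    -- 1)!.
    have hf : (N : ℂ)⁻¹ * N.factorial = (N - 1).factorial := by
      rw [← Nat.mul_factorial_pred (by omega : N ≠ 0)]
      push_cast
      field_simp
    rw [integral_secular_mul_secular hr hs, show 2 * r + 1 + (2 * s + 1) = 2 * (r + s + 1) by ring,
      Even.neg_one_pow ⟨r + s + 1, by ring⟩, one_mul, sqrt_inv_pow_two_mul,
      hermiteKernel_explicit (e := 1) (r := r) (s := s) (by omega) (by omega) le_rfl, pow_succ,
      mul_mul_mul_comm, ← mul_pow, Finset.mul_sum, ← hf]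
    congr 1
    · congr 1
      ring
    · refine Finset.sum_congr rfl fun j _ => ?_
      rw [Nat.sub_sub N (2 * r), Nat.sub_sub N (2 * s)]
      ring
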